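/- Let $G$ be a second countable locally compact Hausdorff groupoid with unit space $G^{(0)}$, range and source maps $r,s$, and a continuous left Haar system $\lambda=(\lambda^x)_{x\in G^{(0)}}$; put $G_x=s^{-1}(x)$ and let $\lambda_x$ be the image of $\lambda^x$ under inversion. Let $E\to G^{(0)}$ be a (Fell--Doran) continuous bundle of complex Hilbert spaces with a continuous action of $G$ by linear isometries $L(\gamma):E_{s(\gamma)}\to E_{r(\gamma)}$, and let $c$ be a continuous cocycle, that is, a continuous section of $r^*E$ with $c(\gamma\gamma')=c(\gamma)+L(\gamma)c(\gamma')$. $C_c(G)$ is the usual convolution $*$-algebra. On the space $C_c(G,r^*E)$ of compactly supported continuous sections put, for $f,g\in C_c(G)$, $$(f\xi)(\gamma)=\int f(\gamma')L(\gamma')\xi(\gamma'^{-1}\gamma)\,d\lambda^{r(\gamma)}(\gamma'),\qquad (\xi g)(\gamma)=\int\xi(\gamma\gamma')g(\gamma'^{-1})\,d\lambda^{s(\gamma)}(\gamma'),$$ $$\langle\xi,\eta\rangle(\gamma)=\int(\xi(\gamma'^{-1})\,|\,\eta(\gamma'^{-1}\gamma))_{s(\gamma')}\,d\lambda^{r(\gamma)}(\gamma').$$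 Let $C^*(G)$ be the completion of $C_c(G)$ for the full norm (the supremum of $\|\pi(f)\|$ over all $*$-representations $\pi$ on Hilbert spaces with $\|\pi(f)\|\le\|f\|_I$), and $C^*_r(G)$ its completion for the reduced norm $\sup_x\|L_x(f)\|$, where $L_x(f)g=f*g$ on $L^2(G_x,\lambda_x)$. Let $C^*(G,r^*E)$ and $C^*_r(G,r^*E)$ be the completions of $C_c(G,r^*E)$ for the norm $\|\langle\xi,\xi\rangle\|^{1/2}$, computed with the full, respectively the reduced, norm. For $f\in C_c(G)$ define $\partial f\in C_c(G,r^*E)$ by $\partial(f)(\gamma)=i\,f(\gamma)\,c(\gamma)$. Then: 1. $\partial$ is a derivation of $C_c(G)$ with values in $C^*(G,r^*E)$, and likewise in $C^*_r(G,r^*E)$: for all $f,g\in C_c(G)$ one has $f*g\in C_c(G)$, $f\,\partial(g)$ and $\partial(f)\,g$ lie in $C_c(G,r^*E)$, and $\partial(f*g)=f\,\partial(g)+\partial(f)\,g$. 2. $\partial$ is a well-defined unbounded linear map from $C^*_r(G)$ to $C^*_r(G,r^*E)$ with domain (the image of) $C_c(G)$, and it is closable: the closure of its graph in $C_r^*(G)\times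 C_r^*(G,r^*E)$ is the graph of a linear map. -/

import Mathlib

open Topology Filter MeasureTheory Bundle
open scoped ENNReal CompactlySupported

universe u v w

/-! ## Topological groupoids and Haar systems -/

/-- A topological groupoid with arrow space `G` and unit space `X`: `r`, `s` are the range and the
source maps, and `mul a b` is defined when `s a = r b`. -/
structure TopGroupoid (X : Type u) (G : Type v) [TopologicalSpace X] [TopologicalSpace G] where
  r : G → X
  s : G → X
  unit : X → G
  inv : G → G
  mul : (a b : G) → s a = r b → G
  r_unit : ∀ x, r (unit x) = x
  s_unit : ∀ x, s (unit x) = x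
  r_inv : ∀ a, r (inv a) = s a
  s_inv : ∀ a, s (inv a) = r a
  r_mul : ∀ a b h, r (mul a b h) = r a
  s_mul : ∀ a b h, s (mul a b h) = s b
  mul_assoc : ∀ a b c (hab : s a = r b) (hbc : s b = r c),
    mul (mul a b hab) c ((s_mul a b hab).trans hbc) =
      mul a (mul b c hbc) (hab.trans (r_mul b c hbc).symm)
  unit_mul : ∀ a, mul (unit (r a)) a (s_unit (r a)) = a
  mul_unit : ∀ a, mul a (unit (s a)) (r_unit (s a)).symm = a
  inv_mul : ∀ a, mul (inv a) a (s_inv a) = unit (s a)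
  mul_inv : ∀ a, mul a (inv a) (r_inv a).symm = unit (r a)
  continuous_r : Continuous r
  continuous_s : Continuous s
  continuous_unit : Continuous unit
  continuous_inv : Continuous inv
  continuous_mul : Continuous fun p : {p : G × G // s p.1 = r p.2} => mul p.1.1 p.1.2 p.2

namespace TopGroupoid

variable {X : Type u} {G : Type v} [TopologicalSpace X] [TopologicalSpace G]

/-- The range fibre `G^x = r⁻¹(x)`. -/
abbrev Fiber (𝒢 : TopGroupoid X G) (x : X) : Type v := {γ : G // 𝒢.r γ = x}

/-- Left translation `G^{s(γ)} → G^{r(γ)}`, `η ↦ γ η`. -/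
def leftMul (𝒢 : TopGroupoid X G) (γ : G) (η : 𝒢.Fiber (𝒢.s γ)) : 𝒢.Fiber (𝒢.r γ) :=
  ⟨𝒢.mul γ η.1 η.2.symm, 𝒢.r_mul _ _ _⟩

/-- The product `η⁻¹ γ` of two arrows with the same range. -/
def invMul (𝒢 : TopGroupoid X G) (γ : G) (η : 𝒢.Fiber (𝒢.r γ)) : G :=
  𝒢.mul (𝒢.inv η.1) γ ((𝒢.s_inv η.1).trans η.2)

theorem r_invMul (𝒢 : TopGroupoid X G) (γ : G) (η : 𝒢.Fiber (𝒢.r γ)) :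
    𝒢.r (𝒢.invMul γ η) = 𝒢.s η.1 :=
  (𝒢.r_mul _ _ _).trans (𝒢.r_inv _)

end TopGroupoid

/-- A (left) Haar system: a family of Radon measures `λ^x` on the fibres `G^x`, of full support,
continuous in `x` and left invariant. -/
structure HaarSystem {X : Type u} {G : Type v} [TopologicalSpace X] [TopologicalSpace G]
    [MeasurableSpace G] (𝒢 : TopGroupoid X G) where
  measure : (x : X) → Measure (𝒢.Fiber x)
  regular : ∀ x, (measure x).Regular
  full_support : ∀ x, (measure x).IsOpenPosMeasure
  continuous_integral : ∀ f : C_c(G, ℂ), Continuous fun x => ∫ γ : 𝒢.Fiber x, f γ.1 ∂(measure x)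
  left_invariant : ∀ γ : G, (measure (𝒢.s γ)).map (𝒢.leftMul γ) = measure (𝒢.r γ)

/-! ## Hilbert bundles -/

/-- The identification of `E x` with `E y` when `x = y`. -/
def fiberCast {X : Type u} {E : X → Type w} {x y : X} (h : x = y) (e : E x) : E y := h ▸ e

@[simp] theorem fiberCast_rfl {X : Type u} {E : X → Type w} {x : X} (h : x = x) (e : E x) :
    fiberCast h e = e := rfl

/-- A continuous bundle of complex Hilbert spaces over `X` in the sense of Fell and Doran. -/
class IsHilbertBundle {X : Type u} [TopologicalSpace X] (E : X → Type w)
    [∀ x, NormedAddCommGroup (E x)] [∀ x, InnerProductSpace ℂ (E x)]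
    [TopologicalSpace (TotalSpace ℂ E)] : Prop where
  complete : ∀ x, CompleteSpace (E x)
  t2 : T2Space (TotalSpace ℂ E)
  continuous_proj : Continuous (TotalSpace.proj : TotalSpace ℂ E → X)
  isOpenMap_proj : IsOpenMap (TotalSpace.proj : TotalSpace ℂ E → X)
  continuous_norm : Continuous fun e : TotalSpace ℂ E => ‖e.2‖
  continuous_add : Continuous
    fun p : {p : TotalSpace ℂ E × TotalSpace ℂ E // p.2.proj = p.1.proj} =>
      (⟨p.1.1.proj, p.1.1.2 + fiberCast p.2 p.1.2.2⟩ : TotalSpace ℂ E)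
  continuous_const_smul : ∀ z : ℂ,
    Continuous fun e : TotalSpace ℂ E => (⟨e.proj, z • e.2⟩ : TotalSpace ℂ E)
  /-- If `‖e_i‖ → 0` and `e_i` lies over `x_i → x`, then `e_i → 0_x`. -/
  tendsto_zero : ∀ x : X,
    comap (TotalSpace.proj : TotalSpace ℂ E → X) (𝓝 x) ⊓
      comap (fun e : TotalSpace ℂ E => ‖e.2‖) (𝓝 0) ≤ 𝓝 (⟨x, 0⟩ : TotalSpace ℂ E)

section Bundles

variable {X : Type u} {G : Type v} [TopologicalSpace X] [TopologicalSpace G]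
  (𝒢 : TopGroupoid X G) (E : X → Type w)
  [∀ x, NormedAddCommGroup (E x)] [∀ x, InnerProductSpace ℂ (E x)]
  [TopologicalSpace (TotalSpace ℂ E)]

/-- A continuous isometric linear action of the groupoid on the Hilbert bundle `E`: it makes `E` a
`G`-Hilbert bundle. The operator `L(γ) : E_{s(γ)} → E_{r(γ)}` is `act γ rfl rfl`; for the sake of
type-checking its source and target are given up to an equality of base points. -/
structure GroupoidAction where
  act : ∀ {x y : X} (γ : G), 𝒢.s γ = x → 𝒢.r γ = y → (E x →ₗᵢ[ℂ] E y)
  act_unit : ∀ (x : X) (e : E x), act (𝒢.unit x) (𝒢.s_unit x) (𝒢.r_unit x) e = e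
  act_mul : ∀ (a b : G) (h : 𝒢.s a = 𝒢.r b) (e : E (𝒢.s b)),
    act (𝒢.mul a b h) (𝒢.s_mul a b h) (𝒢.r_mul a b h) e = act a rfl rfl (act b rfl h.symm e)
  continuous_act : Continuous fun p : {p : G × TotalSpace ℂ E // 𝒢.s p.1 = p.2.proj} =>
    (⟨𝒢.r p.1.1, act p.1.1 p.2 rfl p.1.2.2⟩ : TotalSpace ℂ E)

variable {𝒢 E}

/-- The value at `γ` of a section of the pull-back bundle `r^*E`, seen in `E_x` for `x = r(γ)`. -/
def secAt (ξ : ∀ γ : G, E (𝒢.r γ)) {x : X} (γ : G) (h : 𝒢.r γ = x) : E x :=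
  fiberCast h (ξ γ)

/-- Continuity of a section of the pull-back bundle `r^*E`. -/
def ContinuousSection (ξ : ∀ γ : G, E (𝒢.r γ)) : Prop :=
  Continuous fun γ : G => (⟨𝒢.r γ, ξ γ⟩ : TotalSpace ℂ E)

/-- A continuous (one-)cocycle: a continuous section `c` of `r^*E` such that
`c(γγ') = c(γ) + L(γ) c(γ')`. -/
structure IsContinuousCocycle (L : GroupoidAction 𝒢 E) (c : ∀ γ : G, E (𝒢.r γ)) : Prop where
  continuous : ContinuousSection c
  cocycle : ∀ (a b : G) (h : 𝒢.s a = 𝒢.r b),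
    secAt c (𝒢.mul a b h) (𝒢.r_mul a b h) = c a + L.act a rfl rfl (secAt c b h.symm)

section Continuity

variable [IsHilbertBundle E]

theorem tendsto_total_zero {ι : Type*} {l : Filter ι} {e : ι → TotalSpace ℂ E} {x : X}
    (h1 : Tendsto (fun i => (e i).proj) l (𝓝 x)) (h2 : Tendsto (fun i => ‖(e i).2‖) l (𝓝 0)) :
    Tendsto e l (𝓝 (⟨x, 0⟩ : TotalSpace ℂ E)) :=
  (tendsto_inf.2 ⟨tendsto_comap_iff.2 h1,
    (tendsto_comap_iff (g := fun e : TotalSpace ℂ E => ‖e.2‖)).2 h2⟩).mono_right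
    (IsHilbertBundle.tendsto_zero x)

theorem continuousSection_zero : ContinuousSection (𝒢 := 𝒢) (E := E) (fun _ => 0) := by
  refine continuous_iff_continuousAt.2 fun γ => ?_
  refine tendsto_total_zero (𝒢.continuous_r.tendsto γ) ?_
  simp

theorem ContinuousSection.add {ξ η : ∀ γ : G, E (𝒢.r γ)} (hξ : ContinuousSection ξ)
    (hη : ContinuousSection η) : ContinuousSection (fun γ => ξ γ + η γ) := by
  have h := (IsHilbertBundle.continuous_add (E := E)).comp
    ((Continuous.prodMk hξ hη).subtype_mk
      (p := fun p : TotalSpace ℂ E × TotalSpace ℂ E => p.2.proj = p.1.proj) (fun _ => rfl))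
  exact h

theorem ContinuousSection.const_smul {ξ : ∀ γ : G, E (𝒢.r γ)} (hξ : ContinuousSection ξ) (z : ℂ) :
    ContinuousSection (fun γ => z • ξ γ) :=
  (IsHilbertBundle.continuous_const_smul (E := E) z).comp hξ

theorem ContinuousSection.smul {ξ : ∀ γ : G, E (𝒢.r γ)} (hξ : ContinuousSection ξ) {f : G → ℂ}
    (hf : Continuous f) : ContinuousSection (fun γ => f γ • ξ γ) := by
  refine continuous_iff_continuousAt.2 fun γ₀ => ?_
  have h1 : Tendsto (fun γ => (⟨𝒢.r γ, (f γ - f γ₀) • ξ γ⟩ : TotalSpace ℂ E)) (𝓝 γ₀)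
      (𝓝 ⟨𝒢.r γ₀, 0⟩) := by
    refine tendsto_total_zero (𝒢.continuous_r.tendsto γ₀) ?_
    have hn : Continuous fun γ => ‖ξ γ‖ := (IsHilbertBundle.continuous_norm (E := E)).comp hξ
    have : Tendsto (fun γ => ‖f γ - f γ₀‖ * ‖ξ γ‖) (𝓝 γ₀) (𝓝 (‖f γ₀ - f γ₀‖ * ‖ξ γ₀‖)) :=
      (((hf.sub continuous_const).norm).mul hn).tendsto γ₀
    simpa [norm_smul] using this
  have h2 := (hξ.const_smul (f γ₀)).tendsto γ₀
  have h3 : Tendsto (fun γ => (⟨((⟨𝒢.r γ, f γ₀ • ξ γ⟩ : TotalSpace ℂ E),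
      (⟨𝒢.r γ, (f γ - f γ₀) • ξ γ⟩ : TotalSpace ℂ E)), rfl⟩ :
      {p : TotalSpace ℂ E × TotalSpace ℂ E // p.2.proj = p.1.proj})) (𝓝 γ₀)
      (𝓝 ⟨((⟨𝒢.r γ₀, f γ₀ • ξ γ₀⟩ : TotalSpace ℂ E), (⟨𝒢.r γ₀, 0⟩ : TotalSpace ℂ E)), rfl⟩) :=
    tendsto_subtype_rng.2 (h2.prodMk_nhds h1)
  have h4 := ((IsHilbertBundle.continuous_add (E := E)).tendsto _).comp h3
  have e1 : ((fun p : {p : TotalSpace ℂ E × TotalSpace ℂ E // p.2.proj = p.1.proj} =>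
      (⟨p.1.1.proj, p.1.1.2 + fiberCast p.2 p.1.2.2⟩ : TotalSpace ℂ E)) ∘
      (fun γ => (⟨((⟨𝒢.r γ, f γ₀ • ξ γ⟩ : TotalSpace ℂ E),
      (⟨𝒢.r γ, (f γ - f γ₀) • ξ γ⟩ : TotalSpace ℂ E)), rfl⟩ :
      {p : TotalSpace ℂ E × TotalSpace ℂ E // p.2.proj = p.1.proj}))) =
      fun γ => (⟨𝒢.r γ, f γ • ξ γ⟩ : TotalSpace ℂ E) := by
    funext γ
    simp [← add_smul]
  rw [e1] at h4
  simpa [ContinuousAt] using h4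

variable (𝒢 E) in
/-- The space `C_c(G, r^*E)` of compactly supported continuous sections of `r^*E`. -/
def CcSections : Submodule ℂ (∀ γ : G, E (𝒢.r γ)) where
  carrier := {ξ | ContinuousSection ξ ∧ ∃ K : Set G, IsCompact K ∧ ∀ γ, γ ∉ K → ξ γ = 0}
  zero_mem' := ⟨continuousSection_zero, ∅, isCompact_empty, fun _ _ => rfl⟩
  add_mem' := by
    rintro ξ η ⟨hξ, K, hK, hK'⟩ ⟨hη, K₁, hK₁, hK₁'⟩
    refine ⟨hξ.add hη, K ∪ K₁, hK.union hK₁, fun γ hγ => ?_⟩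
    rw [Set.mem_union, not_or] at hγ
    simp [hK' γ hγ.1, hK₁' γ hγ.2]
  smul_mem' := by
    rintro z ξ ⟨hξ, K, hK, hK'⟩
    exact ⟨hξ.const_smul z, K, hK, fun γ hγ => by simp [hK' γ hγ]⟩

/-- The map `∂ : C_c(G) → C_c(G, r^*E)`, `∂(f)(γ) = i f(γ) c(γ)`. -/
noncomputable def cocycleDerivation (c : ∀ γ : G, E (𝒢.r γ)) (hc : ContinuousSection c) :
    C_c(G, ℂ) →ₗ[ℂ] CcSections 𝒢 E where
  toFun f := ⟨fun γ => (Complex.I * f γ) • c γ,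
    hc.smul (continuous_const.mul f.continuous), tsupport f, f.hasCompactSupport,
    fun γ hγ => by simp [image_eq_zero_of_notMem_tsupport hγ]⟩
  map_add' f g := by
    ext γ
    simp [mul_add, add_smul]
  map_smul' z f := by
    ext γ
    simp [smul_smul, mul_left_comm]

end Continuity

/-! ## Convolution, module actions and inner product -/

section Convolution

variable [MeasurableSpace G] (μ : HaarSystem 𝒢)

/-- `(f * g)(γ) = ∫ f(γγ') g(γ'⁻¹) dλ^{s(γ)}(γ')`. -/
noncomputable def conv (f g : G → ℂ) (γ : G) : ℂ :=
  ∫ η : 𝒢.Fiber (𝒢.s γ), f (𝒢.mul γ η.1 η.2.symm) * g (𝒢.inv η.1) ∂(μ.measure (𝒢.s γ))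

/-- The left action `(f ξ)(γ) = ∫ f(γ') L(γ') ξ(γ'⁻¹γ) dλ^{r(γ)}(γ')`. -/
noncomputable def leftAction (L : GroupoidAction 𝒢 E) (f : G → ℂ) (ξ : ∀ γ : G, E (𝒢.r γ))
    (γ : G) : E (𝒢.r γ) :=
  ∫ η : 𝒢.Fiber (𝒢.r γ),
    f η.1 • L.act η.1 rfl η.2 (secAt ξ (𝒢.invMul γ η) (𝒢.r_invMul γ η)) ∂(μ.measure (𝒢.r γ))

/-- The right action `(ξ g)(γ) = ∫ ξ(γγ') g(γ'⁻¹) dλ^{s(γ)}(γ')`. -/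
noncomputable def rightAction (ξ : ∀ γ : G, E (𝒢.r γ)) (g : G → ℂ) (γ : G) : E (𝒢.r γ) :=
  ∫ η : 𝒢.Fiber (𝒢.s γ),
    g (𝒢.inv η.1) • secAt ξ (𝒢.mul γ η.1 η.2.symm) (𝒢.r_mul _ _ _) ∂(μ.measure (𝒢.s γ))

/-- The `C_c(G)`-valued inner product
`⟨ξ, η⟩(γ) = ∫ (ξ(γ'⁻¹) | η(γ'⁻¹γ))_{s(γ')} dλ^{r(γ)}(γ')`, conjugate linear in `ξ`. -/
noncomputable def innerProd (ξ η : ∀ γ : G, E (𝒢.r γ)) (γ : G) : ℂ :=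
  ∫ τ : 𝒢.Fiber (𝒢.r γ),
    inner ℂ (secAt ξ (𝒢.inv τ.1) (𝒢.r_inv τ.1))
      (secAt η (𝒢.invMul γ τ) (𝒢.r_invMul γ τ)) ∂(μ.measure (𝒢.r γ))

/-! ## The reduced and the full C*-norm -/

/-- The norm of (the restriction to `G_x = s⁻¹(x)` of) `h` in `L²(G_x, λ_x)`, where `λ_x` is the
image of `λ^x` under inversion. -/
noncomputable def sourceL2Norm (x : X) (h : G → ℂ) : ℝ≥0∞ :=
  eLpNorm (fun γ : 𝒢.Fiber x => h (𝒢.inv γ.1)) 2 (μ.measure x)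

/-- The reduced norm `sup_x ‖L_x(f)‖`, where `L_x(f) g = f * g` is the left regular representation
on `L²(G_x, λ_x)`; the operator norm is computed on the dense subspace `C_c(G_x)`, which consists of
the restrictions of elements of `C_c(G)`. -/
noncomputable def reducedNorm (f : G → ℂ) : ℝ≥0∞ :=
  ⨆ (x : X) (g : C_c(G, ℂ)) (_ : sourceL2Norm μ x g ≤ 1), sourceL2Norm μ x (conv μ f g)

/-- The norm `‖f‖_I`: the maximum of `sup_x ∫ |f| dλ^x` and `sup_x ∫ |f| dλ_x`. -/
noncomputable def INorm (f : G → ℂ) : ℝ≥0∞ :=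
  max (⨆ x, ∫⁻ γ : 𝒢.Fiber x, ‖f γ.1‖ₑ ∂(μ.measure x))
    (⨆ x, ∫⁻ γ : 𝒢.Fiber x, ‖f (𝒢.inv γ.1)‖ₑ ∂(μ.measure x))

/-- A `*`-representation of the convolution algebra `C_c(G)` on a Hilbert space, bounded for the
norm `‖·‖_I`. -/
structure BoundedRep where
  H : Type v
  [normed : NormedAddCommGroup H]
  [innerSpace : InnerProductSpace ℂ H]
  [complete : CompleteSpace H]
  rep : C_c(G, ℂ) →ₗ[ℂ] (H →L[ℂ] H)
  map_conv : ∀ f g h : C_c(G, ℂ), (∀ γ, h γ = conv μ f g γ) → rep h = rep f ∘L rep g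
  map_star : ∀ f h : C_c(G, ℂ), (∀ γ, h γ = star (f (𝒢.inv γ))) →
    rep h = ContinuousLinearMap.adjoint (rep f)
  bound : ∀ f : C_c(G, ℂ), ‖rep f‖ₑ ≤ INorm μ f

/-- The full norm of `f ∈ C_c(G)`: the supremum of `‖ρ(f)‖` over all bounded representations. -/
noncomputable def fullNorm (f : G → ℂ) : ℝ≥0∞ :=
  ⨆ (F : C_c(G, ℂ)) (_ : ⇑F = f) (ρ : BoundedRep μ),
    letI := ρ.normed
    letI := ρ.innerSpace
    ‖ρ.rep F‖ₑ

/-- For a C*-norm `N` on `C_c(G)`, the norm `‖ξ‖ = ‖⟨ξ, ξ⟩‖^{1/2}` on sections of `r^*E`. -/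
noncomputable def moduleNorm (N : (G → ℂ) → ℝ≥0∞) (ξ : ∀ γ : G, E (𝒢.r γ)) : ℝ≥0∞ :=
  (N (innerProd μ ξ ξ)) ^ (1 / 2 : ℝ)

end Convolution

end Bundles

/-! ## Completions -/

section Completions

variable {V : Type*} [AddCommGroup V] [Module ℂ V]

/-- The seminorm given by a function `N`. It is written as the largest seminorm below `N`, so that
it is defined before one knows that `N` is a seminorm; if `N` is one, it is `N` itself
(`toSeminorm_eq`). -/
noncomputable def toSeminorm (N : V → ℝ≥0∞) : Seminorm ℂ V :=
  sSup {p : Seminorm ℂ V | ∀ v, ENNReal.ofReal (p v) ≤ N v}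

theorem toSeminorm_eq (N : V → ℝ≥0∞) (p : Seminorm ℂ V) (h : ∀ v, N v = ENNReal.ofReal (p v)) :
    toSeminorm N = p := by
  have hg : IsGreatest {q : Seminorm ℂ V | ∀ v, ENNReal.ofReal (q v) ≤ N v} p := by
    refine ⟨fun v => (h v).ge, fun q hq v => ?_⟩
    have := hq v
    rw [h v] at this
    exact (ENNReal.ofReal_le_ofReal_iff (apply_nonneg p v)).1 this
  exact hg.csSup_eq

/-- The space `V` equipped with the seminorm `p`. -/
def WithSeminorm (_p : Seminorm ℂ V) : Type _ := V

noncomputable instance (p : Seminorm ℂ V) : SeminormedAddCommGroup (WithSeminorm p) :=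
  AddGroupSeminorm.toSeminormedAddCommGroup (E := V) p.toAddGroupSeminorm

noncomputable instance (p : Seminorm ℂ V) : NormedSpace ℂ (WithSeminorm p) where
  toModule := inferInstanceAs (Module ℂ V)
  norm_smul_le z v := (map_smul_eq_mul p z v).le

/-- The (separated) completion of `V` with respect to the norm `N`; it is a Banach space. -/
abbrev NormCompletion (N : V → ℝ≥0∞) : Type _ :=
  UniformSpace.Completion (WithSeminorm (toSeminorm N))

/-- The canonical map of `V` into its completion. -/
noncomputable def toCompletion (N : V → ℝ≥0∞) : V →ₗ[ℂ] NormCompletion N :=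
  (UniformSpace.Completion.toComplₗᵢ (𝕜 := ℂ)
    (E := WithSeminorm (toSeminorm N))).toLinearMap.comp
    ({ toFun := fun v => v, map_add' := fun _ _ => rfl, map_smul' := fun _ _ => rfl } :
      V →ₗ[ℂ] WithSeminorm (toSeminorm N))

end Completions

section Algebras

variable {X : Type u} {G : Type v} [TopologicalSpace X] [TopologicalSpace G] [MeasurableSpace G]
  {𝒢 : TopGroupoid X G} (μ : HaarSystem 𝒢)

/-- The canonical map `C_c(G) → C_r^*(G)` into the completion for the reduced norm. -/
noncomputable def toReducedCStar :
    C_c(G, ℂ) →ₗ[ℂ] NormCompletion (fun f : C_c(G, ℂ) => reducedNorm μ f) :=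
  toCompletion _

variable (E : X → Type w) [∀ x, NormedAddCommGroup (E x)] [∀ x, InnerProductSpace ℂ (E x)]
  [TopologicalSpace (TotalSpace ℂ E)] [IsHilbertBundle E]

/-- The canonical map `C_c(G, r^*E) → C^*(G, r^*E)`. -/
noncomputable def toFullModule : CcSections 𝒢 E →ₗ[ℂ]
    NormCompletion (fun ξ : CcSections 𝒢 E => moduleNorm μ (fullNorm μ) ξ.1) :=
  toCompletion _

/-- The canonical map `C_c(G, r^*E) → C_r^*(G, r^*E)`. -/
noncomputable def toReducedModule : CcSections 𝒢 E →ₗ[ℂ]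
    NormCompletion (fun ξ : CcSections 𝒢 E => moduleNorm μ (reducedNorm μ) ξ.1) :=
  toCompletion _

variable {E}

/-- The linear map `j ∘ δ`, where `δ : C_c(G) → C_c(G, r^*E)` and `j : C_c(G, r^*E) → 𝓜` is the
canonical map into a completion, is a derivation: `C_c(G)` is closed under convolution,
`f δ(g)` and `δ(f) g` lie in `C_c(G, r^*E)`, and `δ(f * g) = f δ(g) + δ(f) g` in `𝓜`. -/
def IsDerivation (L : GroupoidAction 𝒢 E) {𝓜 : Type*} [AddCommGroup 𝓜] [Module ℂ 𝓜]
    (j : CcSections 𝒢 E →ₗ[ℂ] 𝓜) (δ : C_c(G, ℂ) →ₗ[ℂ] CcSections 𝒢 E) : Prop :=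
  ∀ f g : C_c(G, ℂ), ∃ (h : C_c(G, ℂ)) (ξ η : CcSections 𝒢 E),
    (∀ γ, h γ = conv μ f g γ) ∧ (∀ γ, ξ.1 γ = leftAction μ L f (δ g).1 γ) ∧
    (∀ γ, η.1 γ = rightAction μ (δ f).1 g γ) ∧ j (δ h) = j ξ + j η

end Algebras

/-! Leibniz rule. After left translation, `(f * g)(γ) = ∫ f(η) g(η⁻¹γ) dλ^{r(γ)}(η)`. Under this
integral the cocycle identity `c(γ) = c(η) + L(η) c(η⁻¹γ)` splits `i (f * g)(γ) c(γ)` into the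
integrands of `∂(f) g` and `f ∂(g)`. The identity holds in `C_c(G, r^*E)`, whatever the norm. The
analytic work is to show that fibre integrals of compactly supported continuous data are continuous
again (`continuous_integral_fiber`, `continuousAlong_integral_fiber`).

Closability. Identify `G_x` with `G^x` by inversion. A section `ξ` then gives the operator `T_ξ`
with kernel `L(ζ) ξ(ζ⁻¹η)` from scalar functions to `E_x`-valued functions, and convolution by `⟨ξ,
ξ⟩` is `T_ξ^* T_ξ` (`inner_toSourceLp_convCc_innerProdCc`). Hence the reduced module norm of `ξ` is
the supremum of `‖T_ξ g‖` over `x` and `g` in the unit ball (`enorm_fiberOpLp_le`,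
`moduleNorm_reducedNorm_le`).

By the cocycle identity `T_{∂f}` has kernel `i f(ζ⁻¹η) (c(η) - c(ζ))`: it is, up to `i`, the
commutator of convolution by `f` with multiplication by `c`. Suppose `f_n → 0` in the reduced norm
and `T_{∂f_n} g → y` in `L²`. For `e ∈ E_x`, the scalar `(e | T_{∂f_n} g)(ζ)` combines `f_n * g'`
and `f_n * g` with coefficients independent of `n`, where `g'` absorbs `(e | c)`. Both convolutions
tend to `0` in `L²`, hence a.e. along a subsequence, so `y = 0` (`eq_zero_of_tendsto_fiberOpLp`). A
supremum of seminorms, each giving a closable map, gives a closable map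
(`eq_zero_of_mem_closure_range`). -/

set_option linter.unusedSectionVars false

/-! ## Algebra of groupoids -/

namespace TopGroupoid

section Algebra

variable {X : Type u} {G : Type v} [TopologicalSpace X] [TopologicalSpace G]
  (𝒢 : TopGroupoid X G)

theorem mul_congr {a a' b b' : G} (ha : a = a') (hb : b = b') (h : 𝒢.s a = 𝒢.r b) :
    𝒢.mul a b h = 𝒢.mul a' b' (by rw [← ha, ← hb]; exact h) := by
  subst ha hb; rfl

theorem unit_mul' {x : X} {b : G} (hx : x = 𝒢.r b) (h : 𝒢.s (𝒢.unit x) = 𝒢.r b) :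
    𝒢.mul (𝒢.unit x) b h = b := by
  subst hx; exact 𝒢.unit_mul b

theorem mul_unit' {x : X} {a : G} (hx : x = 𝒢.s a) (h : 𝒢.s a = 𝒢.r (𝒢.unit x)) :
    𝒢.mul a (𝒢.unit x) h = a := by
  subst hx; exact 𝒢.mul_unit a

/-- The product `a⁻¹ b` of two arrows with the same range. -/
def ldiv (a b : G) (h : 𝒢.r a = 𝒢.r b) : G := 𝒢.mul (𝒢.inv a) b ((𝒢.s_inv a).trans h)

theorem r_ldiv (a b : G) (h : 𝒢.r a = 𝒢.r b) : 𝒢.r (𝒢.ldiv a b h) = 𝒢.s a :=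
  (𝒢.r_mul _ _ _).trans (𝒢.r_inv a)

theorem ldiv_congr {a a' b b' : G} (ha : a = a') (hb : b = b') (h : 𝒢.r a = 𝒢.r b) :
    𝒢.ldiv a b h = 𝒢.ldiv a' b' (by rw [← ha, ← hb]; exact h) := by
  subst ha hb; rfl

theorem ldiv_mul_self_left (a b : G) (h : 𝒢.s a = 𝒢.r b) :
    𝒢.ldiv a (𝒢.mul a b h) (𝒢.r_mul a b h).symm = b := by
  unfold ldiv
  rw [← 𝒢.mul_assoc (𝒢.inv a) a b (𝒢.s_inv a) h,
    𝒢.mul_congr (𝒢.inv_mul a) rfl, 𝒢.unit_mul' h]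

theorem mul_ldiv (a b : G) (h : 𝒢.r a = 𝒢.r b) :
    𝒢.mul a (𝒢.ldiv a b h) (𝒢.r_ldiv a b h).symm = b := by
  unfold ldiv
  rw [← 𝒢.mul_assoc a (𝒢.inv a) b (𝒢.r_inv a).symm _,
    𝒢.mul_congr (𝒢.mul_inv a) rfl, 𝒢.unit_mul' h]

theorem mul_inv_cancel_right (a b : G) (h : 𝒢.s a = 𝒢.r b) :
    𝒢.mul (𝒢.mul a b h) (𝒢.inv b) ((𝒢.s_mul a b h).trans (𝒢.r_inv b).symm) = a := by
  rw [𝒢.mul_assoc a b (𝒢.inv b) h (𝒢.r_inv b).symm, 𝒢.mul_congr rfl (𝒢.mul_inv b),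
    𝒢.mul_unit' h.symm]

theorem inv_inv (a : G) : 𝒢.inv (𝒢.inv a) = a := by
  have h := 𝒢.ldiv_mul_self_left (𝒢.inv a) a (𝒢.s_inv a)
  unfold ldiv at h
  rwa [𝒢.mul_congr rfl (𝒢.inv_mul a), 𝒢.mul_unit' (by rw [s_inv, r_inv])] at h

theorem ldiv_mul_self_right (a b : G) (h : 𝒢.s a = 𝒢.r b) :
    𝒢.ldiv (𝒢.mul a b h) a (𝒢.r_mul a b h) = 𝒢.inv b := by
  have h1 := 𝒢.ldiv_mul_self_left (𝒢.mul a b h) (𝒢.inv b)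
    ((𝒢.s_mul a b h).trans (𝒢.r_inv b).symm)
  rwa [𝒢.ldiv_congr rfl (𝒢.mul_inv_cancel_right a b h)] at h1

theorem inv_ldiv (a b : G) (h : 𝒢.r a = 𝒢.r b) :
    𝒢.inv (𝒢.ldiv a b h) = 𝒢.ldiv b a h.symm := by
  rw [← 𝒢.ldiv_mul_self_right a (𝒢.ldiv a b h) (𝒢.r_ldiv a b h).symm]
  exact 𝒢.ldiv_congr (𝒢.mul_ldiv a b h) rfl _

theorem ldiv_mul (a b d : G) (h : 𝒢.s a = 𝒢.r b) (h' : 𝒢.r a = 𝒢.r d) :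
    𝒢.ldiv (𝒢.mul a b h) d ((𝒢.r_mul a b h).trans h') =
      𝒢.ldiv b (𝒢.ldiv a d h') (h.symm.trans (𝒢.r_ldiv a d h').symm) := by
  have e : 𝒢.mul (𝒢.mul a b h) (𝒢.ldiv b (𝒢.ldiv a d h') (h.symm.trans (𝒢.r_ldiv a d h').symm))
      ((𝒢.s_mul a b h).trans (𝒢.r_ldiv _ _ _).symm) = d := by
    rw [𝒢.mul_assoc a b _ h (𝒢.r_ldiv _ _ _).symm, 𝒢.mul_congr rfl (𝒢.mul_ldiv b _ _),
      𝒢.mul_ldiv]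
  have h1 := 𝒢.ldiv_mul_self_left (𝒢.mul a b h) _ ((𝒢.s_mul a b h).trans
    (𝒢.r_ldiv b (𝒢.ldiv a d h') (h.symm.trans (𝒢.r_ldiv a d h').symm)).symm)
  rwa [𝒢.ldiv_congr rfl e] at h1

end Algebra

/-! ## Topology of groupoids -/

section Topology

variable {X : Type u} {G : Type v} [TopologicalSpace X] [TopologicalSpace G]
  (𝒢 : TopGroupoid X G)

theorem continuous_mul_comp {Z : Type*} [TopologicalSpace Z] {a b : Z → G} (ha : Continuous a)
    (hb : Continuous b) (h : ∀ z, 𝒢.s (a z) = 𝒢.r (b z)) :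
    Continuous fun z => 𝒢.mul (a z) (b z) (h z) :=
  𝒢.continuous_mul.comp ((ha.prodMk hb).subtype_mk h)

theorem continuous_ldiv_comp {Z : Type*} [TopologicalSpace Z] {a b : Z → G} (ha : Continuous a)
    (hb : Continuous b) (h : ∀ z, 𝒢.r (a z) = 𝒢.r (b z)) :
    Continuous fun z => 𝒢.ldiv (a z) (b z) (h z) :=
  𝒢.continuous_mul_comp (𝒢.continuous_inv.comp ha) hb _

/-- The set of products of composable pairs in `A × B`. -/
def mulSet (A B : Set G) : Set G :=
  {γ | ∃ a ∈ A, ∃ b ∈ B, ∃ h : 𝒢.s a = 𝒢.r b, 𝒢.mul a b h = γ}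

theorem mul_mem_mulSet {A B : Set G} {a b : G} (ha : a ∈ A) (hb : b ∈ B) (h : 𝒢.s a = 𝒢.r b) :
    𝒢.mul a b h ∈ 𝒢.mulSet A B := ⟨a, ha, b, hb, h, rfl⟩

variable [T2Space G]

theorem t2Space_units (𝒢 : TopGroupoid X G) : T2Space X :=
  T2Space.of_injective_continuous (f := 𝒢.unit)
    (fun x y h => by rw [← 𝒢.r_unit x, h, 𝒢.r_unit]) 𝒢.continuous_unit

theorem isClosed_fiber (x : X) : IsClosed {γ : G | 𝒢.r γ = x} :=
  have := 𝒢.t2Space_units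
  isClosed_eq 𝒢.continuous_r continuous_const

theorem isClosedEmbedding_fiber (x : X) : IsClosedEmbedding (Subtype.val : 𝒢.Fiber x → G) :=
  (𝒢.isClosed_fiber x).isClosedEmbedding_subtypeVal

theorem isCompact_fiber_preimage (x : X) {K : Set G} (hK : IsCompact K) :
    IsCompact ((Subtype.val : 𝒢.Fiber x → G) ⁻¹' K) :=
  (𝒢.isClosedEmbedding_fiber x).isCompact_preimage hK

/-- Units are Hausdorff, so the composable pairs are closed in `G × G`; those in `A × B` form a
compact set, mapped continuously by the product. -/
theorem isCompact_mulSet {A B : Set G} (hA : IsCompact A) (hB : IsCompact B) :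
    IsCompact (𝒢.mulSet A B) := by
  have := 𝒢.t2Space_units
  have hc : IsClosed {p : G × G | 𝒢.s p.1 = 𝒢.r p.2} :=
    isClosed_eq (𝒢.continuous_s.comp continuous_fst) (𝒢.continuous_r.comp continuous_snd)
  have h1 := (hc.isClosedEmbedding_subtypeVal.isCompact_preimage (hA.prod hB)).image
    𝒢.continuous_mul
  convert h1 using 1
  ext γ
  constructor
  · rintro ⟨a, ha, b, hb, h, rfl⟩
    exact ⟨⟨(a, b), h⟩, ⟨ha, hb⟩, rfl⟩
  · rintro ⟨⟨⟨a, b⟩, h⟩, ⟨ha, hb⟩, rfl⟩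
    exact ⟨a, ha, b, hb, h, rfl⟩

instance instLocallyCompactFiber [LocallyCompactSpace G] (x : X) :
    LocallyCompactSpace (𝒢.Fiber x) :=
  (𝒢.isClosedEmbedding_fiber x).locallyCompactSpace

instance instSecondCountableFiber [SecondCountableTopology G] (x : X) :
    SecondCountableTopology (𝒢.Fiber x) :=
  TopologicalSpace.Subtype.secondCountableTopology {γ | 𝒢.r γ = x}

end Topology

/-- Left translation `G^{s(γ)} → G^{r(γ)}` as a homeomorphism. -/
def leftMulHomeomorph {X : Type u} {G : Type v} [TopologicalSpace X] [TopologicalSpace G]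
    (𝒢 : TopGroupoid X G) (γ : G) : 𝒢.Fiber (𝒢.s γ) ≃ₜ 𝒢.Fiber (𝒢.r γ) where
  toFun := 𝒢.leftMul γ
  invFun η := ⟨𝒢.ldiv γ η.1 η.2.symm, 𝒢.r_ldiv _ _ _⟩
  left_inv η := Subtype.ext (𝒢.ldiv_mul_self_left γ η.1 η.2.symm)
  right_inv η := Subtype.ext (𝒢.mul_ldiv γ η.1 η.2.symm)
  continuous_toFun :=
    (𝒢.continuous_mul_comp continuous_const continuous_subtype_val _).subtype_mk _
  continuous_invFun :=
    (𝒢.continuous_ldiv_comp continuous_const continuous_subtype_val _).subtype_mk _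

end TopGroupoid

/-! ## Integration along the fibres -/

namespace HaarSystem

variable {X : Type u} {G : Type v} [TopologicalSpace X] [TopologicalSpace G]
  [MeasurableSpace G] {𝒢 : TopGroupoid X G} (μ : HaarSystem 𝒢)

instance instRegularMeasure (x : X) : (μ.measure x).Regular := μ.regular x

theorem integral_congr_base {V : Type*} [NormedAddCommGroup V] [NormedSpace ℝ V] {x y : X}
    (h : x = y) (F : ∀ γ : G, 𝒢.r γ = x → V) :
    ∫ η : 𝒢.Fiber x, F η.1 η.2 ∂(μ.measure x) =
      ∫ η : 𝒢.Fiber y, F η.1 (η.2.trans h.symm) ∂(μ.measure y) := by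
  subst h; rfl

variable [BorelSpace G]

/-- Left invariance as the substitution `η ↦ γη`. The base points are variables tied to `s γ` and `r
γ` by equations, so that it applies on a fibre `G^x` where `r(γ) = x` is only a hypothesis. -/
theorem integral_translate {V : Type*} [NormedAddCommGroup V] [NormedSpace ℝ V] {x y : X} (γ : G)
    (hs : 𝒢.s γ = x) (hr : 𝒢.r γ = y) (F : ∀ η : G, 𝒢.r η = y → V) :
    ∫ η : 𝒢.Fiber y, F η.1 η.2 ∂(μ.measure y) =
      ∫ η : 𝒢.Fiber x, F (𝒢.mul γ η.1 (hs.trans η.2.symm)) ((𝒢.r_mul _ _ _).trans hr)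
        ∂(μ.measure x) := by
  subst hs hr
  rw [← μ.left_invariant γ]
  exact (𝒢.leftMulHomeomorph γ).measurableEmbedding.integral_map _

theorem lintegral_translate {x y : X} (γ : G)
    (hs : 𝒢.s γ = x) (hr : 𝒢.r γ = y) (F : ∀ η : G, 𝒢.r η = y → ℝ≥0∞) :
    ∫⁻ η : 𝒢.Fiber y, F η.1 η.2 ∂(μ.measure y) =
      ∫⁻ η : 𝒢.Fiber x, F (𝒢.mul γ η.1 (hs.trans η.2.symm)) ((𝒢.r_mul _ _ _).trans hr)
        ∂(μ.measure x) := by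
  subst hs hr
  rw [← μ.left_invariant γ]
  exact (𝒢.leftMulHomeomorph γ).measurableEmbedding.lintegral_map _

end HaarSystem

/-! ### Cutoff functions and extension from closed subsets -/

section Extension

variable {Y : Type*} [TopologicalSpace Y] [T2Space Y] [LocallyCompactSpace Y]

theorem exists_compactlySupported_eq_one {K : Set Y} (hK : IsCompact K) :
    ∃ ψ : C_c(Y, ℂ), (∀ y, 0 ≤ (ψ y).re) ∧ ∀ y ∈ K, ψ y = 1 := by
  obtain ⟨f, hf1, -, hf2, hf3⟩ := exists_continuous_one_zero_of_isCompact hK isClosed_empty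
    (Set.disjoint_empty K)
  refine ⟨⟨⟨fun y => (f y : ℂ), by fun_prop⟩, ?_⟩, fun y => ?_, fun y hy => ?_⟩
  · exact hf2.comp_left (g := fun t : ℝ => (t : ℂ)) (by simp)
  · simpa using (hf3 y).1
  · simpa using hf1 hy

variable [SecondCountableTopology Y]

/-- Tietze's theorem gives a continuous extension. Multiplying by a cutoff equal to `1` on `K` makes
its support compact without changing it on `S`, because `f` vanishes off `K`. It is used with `S` a
range fibre. -/
theorem exists_compactlySupported_extension {S : Set Y} (hS : IsClosed S) {f : S → ℂ}
    (hf : Continuous f) {K : Set Y} (hK : IsCompact K) (hfK : ∀ y : S, y.1 ∉ K → f y = 0) :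
    ∃ φ : C_c(Y, ℂ), ∀ y : S, φ y.1 = f y := by
  obtain ⟨g, hg⟩ := ContinuousMap.exists_restrict_eq hS (⟨f, hf⟩ : C(S, ℂ))
  obtain ⟨ψ, -, hψ⟩ := exists_compactlySupported_eq_one hK
  refine ⟨⟨⟨fun y => ψ y * g y, by fun_prop⟩, ?_⟩, fun y => ?_⟩
  · exact ψ.hasCompactSupport.mul_right
  · have hgy : g y.1 = f y := DFunLike.congr_fun hg y
    change ψ y.1 * g y.1 = f y
    by_cases hy : y.1 ∈ K
    · rw [hψ _ hy, hgy, one_mul]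
    · rw [hgy, hfK y hy, mul_zero]

end Extension

/-! ## Continuity in Hilbert bundles -/

section BundleContinuity

variable {X : Type u} [TopologicalSpace X] {E : X → Type w}
  [∀ x, NormedAddCommGroup (E x)] [∀ x, InnerProductSpace ℂ (E x)]
  [TopologicalSpace (TotalSpace ℂ E)]

/-- Continuity of a section `a` of the pull-back of the bundle `E` along `p : Z → X`. -/
def ContinuousAlong {Z : Type*} [TopologicalSpace Z] (p : Z → X) (a : ∀ z, E (p z)) : Prop :=
  Continuous fun z => (⟨p z, a z⟩ : TotalSpace ℂ E)

theorem totalSpace_fiberCast {x y : X} (h : x = y) (e : E x) :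
    (⟨y, fiberCast h e⟩ : TotalSpace ℂ E) = ⟨x, e⟩ := by
  subst h; rfl

variable [IsHilbertBundle E] {Z : Type*} [TopologicalSpace Z] {p : Z → X}

namespace ContinuousAlong

variable {a b : ∀ z, E (p z)}

theorem continuous_base (ha : ContinuousAlong p a) : Continuous p :=
  (IsHilbertBundle.continuous_proj (E := E)).comp ha

theorem norm (ha : ContinuousAlong p a) : Continuous fun z => ‖a z‖ :=
  (IsHilbertBundle.continuous_norm (E := E)).comp ha

theorem add (ha : ContinuousAlong p a) (hb : ContinuousAlong p b) :
    ContinuousAlong p fun z => a z + b z :=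
  (IsHilbertBundle.continuous_add (E := E)).comp ((Continuous.prodMk ha hb).subtype_mk
    (p := fun p : TotalSpace ℂ E × TotalSpace ℂ E => p.2.proj = p.1.proj) (fun _ => rfl))

theorem const_smul (ha : ContinuousAlong p a) (k : ℂ) : ContinuousAlong p fun z => k • a z :=
  (IsHilbertBundle.continuous_const_smul (E := E) k).comp ha

theorem sub (ha : ContinuousAlong p a) (hb : ContinuousAlong p b) :
    ContinuousAlong p fun z => a z - b z := by
  simpa [sub_eq_add_neg] using ha.add (hb.const_smul (-1))

/-- The bundle axioms only give continuity of the norm; polarization yields that of the inner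
product. -/
theorem inner (ha : ContinuousAlong p a) (hb : ContinuousAlong p b) :
    Continuous fun z => inner ℂ (a z) (b z) := by
  simp_rw [inner_eq_sum_norm_sq_div_four]
  have h1 := (ha.add hb).norm
  have h2 := (ha.sub hb).norm
  have h3 := (ha.sub (hb.const_smul (RCLike.I : ℂ))).norm
  have h4 := (ha.add (hb.const_smul (RCLike.I : ℂ))).norm
  have hc : Continuous (fun t : ℝ => ((t : ℝ) : ℂ)) := Complex.continuous_ofReal
  exact ((((hc.comp h1).pow 2).sub ((hc.comp h2).pow 2)).add
    ((((hc.comp h3).pow 2).sub ((hc.comp h4).pow 2)).mul continuous_const)).div_const _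

/-- Only multiplication by a fixed scalar is continuous by axiom. Write `f(z) a(z) = f(z₀) a(z) +
(f(z) - f(z₀)) a(z)`; the last term has norm tending to `0`, hence tends to the zero vector over
`p(z₀)`. -/
theorem smul (ha : ContinuousAlong p a) {f : Z → ℂ} (hf : Continuous f) :
    ContinuousAlong p fun z => f z • a z := by
  refine continuous_iff_continuousAt.2 fun z₀ => ?_
  have h1 : Tendsto (fun z => (⟨p z, (f z - f z₀) • a z⟩ : TotalSpace ℂ E)) (𝓝 z₀)
      (𝓝 ⟨p z₀, 0⟩) := by
    refine tendsto_total_zero (ha.continuous_base.tendsto z₀) ?_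
    have : Tendsto (fun z => ‖f z - f z₀‖ * ‖a z‖) (𝓝 z₀) (𝓝 (‖f z₀ - f z₀‖ * ‖a z₀‖)) :=
      (((hf.sub continuous_const).norm).mul ha.norm).tendsto z₀
    simpa [norm_smul] using this
  have h3 : Tendsto (fun z => (⟨((⟨p z, f z₀ • a z⟩ : TotalSpace ℂ E),
      (⟨p z, (f z - f z₀) • a z⟩ : TotalSpace ℂ E)), rfl⟩ :
      {p : TotalSpace ℂ E × TotalSpace ℂ E // p.2.proj = p.1.proj})) (𝓝 z₀)
      (𝓝 ⟨((⟨p z₀, f z₀ • a z₀⟩ : TotalSpace ℂ E), (⟨p z₀, 0⟩ : TotalSpace ℂ E)), rfl⟩) :=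
    tendsto_subtype_rng.2 (((ha.const_smul (f z₀)).tendsto z₀).prodMk_nhds h1)
  have h4 := ((IsHilbertBundle.continuous_add (E := E)).tendsto _).comp h3
  simpa [ContinuousAt, Function.comp_def, ← add_smul] using h4

theorem comp (ha : ContinuousAlong p a) {W : Type*} [TopologicalSpace W] {q : W → Z}
    (hq : Continuous q) : ContinuousAlong (fun w => p (q w)) fun w => a (q w) :=
  Continuous.comp ha hq

/-- The total space topology restricts to the norm topology on a single fibre: subtract the constant
section `a(z₀)` and use continuity of the norm. -/
theorem continuous_of_const {x : X} {a : Z → E x} (ha : ContinuousAlong (fun _ => x) a) :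
    Continuous a := by
  refine continuous_iff_continuousAt.2 fun z₀ => ?_
  have hc : ContinuousAlong (fun _ : Z => x) (fun _ => a z₀) :=
    continuous_const (y := (⟨x, a z₀⟩ : TotalSpace ℂ E))
  have h := (ha.sub hc).norm.tendsto z₀
  rw [sub_self, norm_zero] at h
  exact tendsto_iff_norm_sub_tendsto_zero.2 h

/-- If `a` is close to the tautological section along the pull-back of the total space, then `a`
is continuous. -/
theorem of_continuous_norm_sub (hp : Continuous p)
    (h : Continuous fun w : {w : Z × TotalSpace ℂ E // w.2.proj = p w.1} =>
      ‖fiberCast w.2 w.1.2.2 - a w.1.1‖) : ContinuousAlong p a := by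
  refine continuous_iff_continuousAt.2 fun z₀ => ?_
  let W := {w : Z × TotalSpace ℂ E // w.2.proj = p w.1}
  let w₀ : W := ⟨(z₀, ⟨p z₀, a z₀⟩), rfl⟩
  have hq : Continuous fun w : W => w.1.1 := continuous_fst.comp continuous_subtype_val
  have hu : ContinuousAlong (fun w : W => p w.1.1)
      (fun w => fiberCast w.2 w.1.2.2) := by
    have h0 : Continuous fun w : W => w.1.2 := continuous_snd.comp continuous_subtype_val
    refine h0.congr fun w => (totalSpace_fiberCast w.2 w.1.2.2).symm
  -- The bundle projection is open, so every `z` near `z₀` lifts to a point of `W` near `w₀`. A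
  -- limit along `W` therefore descends to `Z`.
  have hopen : 𝓝 z₀ ≤ map (fun w : W => w.1.1) (𝓝 w₀) := by
    intro S hS
    rw [mem_map, nhds_subtype_eq_comap, mem_comap] at hS
    obtain ⟨T, hT, hTS⟩ := hS
    obtain ⟨A, hA, B, hB, hAB⟩ := mem_nhds_prod_iff.1 hT
    have hB' := hp.continuousAt.preimage_mem_nhds
      ((IsHilbertBundle.isOpenMap_proj (E := E)).image_mem_nhds hB)
    filter_upwards [hA, hB'] with z hzA hzB
    obtain ⟨u, huB, hu⟩ := hzB
    exact @hTS ⟨(z, u), hu⟩ (hAB ⟨hzA, huB⟩)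
  -- On `W` write `a = u + (a - u)` with `u` the tautological section. It is continuous, and `a - u`
  -- tends to zero at `w₀`, where `u` equals `a(z₀)`.
  have h1 : Tendsto (fun w : W => (⟨p w.1.1, a w.1.1 - fiberCast w.2 w.1.2.2⟩ : TotalSpace ℂ E))
      (𝓝 w₀) (𝓝 ⟨p z₀, 0⟩) := by
    refine tendsto_total_zero ((hp.comp hq).tendsto w₀) ?_
    have h2 := h.tendsto w₀
    simp only [norm_sub_rev (fiberCast _ _)] at h2
    simpa [w₀] using h2
  have h3 : Tendsto (fun w : W => (⟨((⟨p w.1.1, fiberCast w.2 w.1.2.2⟩ : TotalSpace ℂ E),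
      (⟨p w.1.1, a w.1.1 - fiberCast w.2 w.1.2.2⟩ : TotalSpace ℂ E)), rfl⟩ :
      {p : TotalSpace ℂ E × TotalSpace ℂ E // p.2.proj = p.1.proj})) (𝓝 w₀)
      (𝓝 ⟨((⟨p z₀, a z₀⟩ : TotalSpace ℂ E), (⟨p z₀, 0⟩ : TotalSpace ℂ E)), rfl⟩) :=
    tendsto_subtype_rng.2 ((hu.tendsto w₀).prodMk_nhds h1)
  have h4 := ((IsHilbertBundle.continuous_add (E := E)).tendsto _).comp h3
  have h5 : Tendsto ((fun z => (⟨p z, a z⟩ : TotalSpace ℂ E)) ∘ fun w : W => w.1.1) (𝓝 w₀)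
      (𝓝 ⟨p z₀, a z₀⟩) := by
    simpa [Function.comp_def] using h4
  exact (tendsto_map'_iff.2 h5).mono_left hopen

end ContinuousAlong

end BundleContinuity

/-! ### Sections of the pull-back bundle and the groupoid action along maps -/

section Sections

variable {X : Type u} {G : Type v} [TopologicalSpace X] [TopologicalSpace G]
  {𝒢 : TopGroupoid X G} {E : X → Type w}
  [∀ x, NormedAddCommGroup (E x)] [∀ x, InnerProductSpace ℂ (E x)]
  [TopologicalSpace (TotalSpace ℂ E)]

theorem totalSpace_secAt (ξ : ∀ γ : G, E (𝒢.r γ)) {x : X} (γ : G) (h : 𝒢.r γ = x) :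
    (⟨x, secAt ξ γ h⟩ : TotalSpace ℂ E) = ⟨𝒢.r γ, ξ γ⟩ := totalSpace_fiberCast h _

theorem secAt_congr (ξ : ∀ γ : G, E (𝒢.r γ)) {x : X} {γ γ' : G} (e : γ = γ') (h : 𝒢.r γ = x) :
    secAt ξ γ h = secAt ξ γ' (by rw [← e]; exact h) := by
  subst e; rfl

@[simp] theorem secAt_rfl (ξ : ∀ γ : G, E (𝒢.r γ)) (γ : G) : secAt ξ γ rfl = ξ γ := rfl

theorem secAt_add (ξ η : ∀ γ : G, E (𝒢.r γ)) {x : X} (γ : G) (h : 𝒢.r γ = x) :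
    secAt (ξ + η) γ h = secAt ξ γ h + secAt η γ h := by subst h; rfl

theorem secAt_const_smul (k : ℂ) (ξ : ∀ γ : G, E (𝒢.r γ)) {x : X} (γ : G) (h : 𝒢.r γ = x) :
    secAt (k • ξ) γ h = k • secAt ξ γ h := by subst h; rfl

theorem secAt_eq_zero {ξ : ∀ γ : G, E (𝒢.r γ)} {x : X} {γ : G} (h : 𝒢.r γ = x) (h0 : ξ γ = 0) :
    secAt ξ γ h = 0 := by subst h; exact h0

theorem ContinuousSection.secAt_along {ξ : ∀ γ : G, E (𝒢.r γ)}
    (hξ : ContinuousSection ξ) {Z : Type*} [TopologicalSpace Z] {p : Z → X} {γ : Z → G}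
    (hγ : Continuous γ) (h : ∀ z, 𝒢.r (γ z) = p z) :
    ContinuousAlong p fun z => secAt ξ (γ z) (h z) :=
  (Continuous.comp hξ hγ).congr fun z => (totalSpace_secAt ξ (γ z) (h z)).symm

namespace GroupoidAction

variable (L : GroupoidAction 𝒢 E)

theorem continuousAlong_act {Z : Type*} [TopologicalSpace Z] {p q : Z → X} {γ : Z → G}
    (hγ : Continuous γ) (hs : ∀ z, 𝒢.s (γ z) = p z) (hr : ∀ z, 𝒢.r (γ z) = q z)
    {a : ∀ z, E (p z)} (ha : ContinuousAlong p a) :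
    ContinuousAlong q fun z => L.act (γ z) (hs z) (hr z) (a z) := by
  have h := L.continuous_act.comp ((Continuous.prodMk hγ ha).subtype_mk
    (p := fun p : G × TotalSpace ℂ E => 𝒢.s p.1 = p.2.proj) hs)
  refine Continuous.congr h fun z => ?_
  have key : ∀ (y : X) (e : 𝒢.r (γ z) = y), (⟨𝒢.r (γ z), L.act (γ z) (hs z) rfl (a z)⟩ :
    TotalSpace ℂ E) = ⟨y, L.act (γ z) (hs z) e (a z)⟩ := by
    rintro y rfl; rfl
  exact key _ (hr z)

end GroupoidAction

end Sections

/-! ## Continuity of integrals along the fibres -/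

namespace HaarSystem

variable {X : Type u} {G : Type v} [TopologicalSpace X] [TopologicalSpace G]
  [T2Space G] [LocallyCompactSpace G] [SecondCountableTopology G]
  [MeasurableSpace G] [BorelSpace G] {𝒢 : TopGroupoid X G} (μ : HaarSystem 𝒢)

theorem integrable_fiber_of_compact {V : Type*} [NormedAddCommGroup V] {x : X}
    {F : 𝒢.Fiber x → V} (hF : Continuous F) {K : Set G} (hK : IsCompact K)
    (hFK : ∀ η : 𝒢.Fiber x, η.1 ∉ K → F η = 0) : Integrable F (μ.measure x) :=
  hF.integrable_of_hasCompactSupport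
    (HasCompactSupport.intro (𝒢.isCompact_fiber_preimage x hK) fun η hη => hFK η hη)

theorem integrable_fiber (φ : C_c(G, ℂ)) (x : X) :
    Integrable (fun η : 𝒢.Fiber x => φ η.1) (μ.measure x) :=
  μ.integrable_fiber_of_compact (φ.continuous.comp continuous_subtype_val)
    φ.hasCompactSupport fun _ hη => image_eq_zero_of_notMem_tsupport hη

variable {Z : Type*} [TopologicalSpace Z] {p : Z → X}

theorem continuous_fiber_of_continuous {V : Type*} [TopologicalSpace V]
    {F : ∀ (z : Z) (η : G), 𝒢.r η = p z → V}
    (hF : Continuous fun q : {q : Z × G // 𝒢.r q.2 = p q.1} => F q.1.1 q.1.2 q.2) (z : Z) :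
    Continuous fun η : 𝒢.Fiber (p z) => F z η.1 η.2 :=
  hF.comp ((continuous_const.prodMk continuous_subtype_val).subtype_mk
    (p := fun q : Z × G => 𝒢.r q.2 = p q.1) (fun η : 𝒢.Fiber (p z) => η.2))

/-- The Haar system axiom covers only integrands that are restrictions of one function on `G`. Near
`z₀` replace `F z` by an extension `φ ∈ C_c(G)` of `F z₀`. By compactness `F z` is uniformly close
to `φ` on the fibre over `p z`, and the error is dominated by a small multiple of a fixed cutoff
`ψ`. -/
theorem continuous_integral_fiber (hp : Continuous p)
    {F : ∀ (z : Z) (η : G), 𝒢.r η = p z → ℂ}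
    (hF : Continuous fun q : {q : Z × G // 𝒢.r q.2 = p q.1} => F q.1.1 q.1.2 q.2)
    {K : Set G} (hK : IsCompact K) (hFK : ∀ z η h, η ∉ K → F z η h = 0) :
    Continuous fun z => ∫ η : 𝒢.Fiber (p z), F z η.1 η.2 ∂(μ.measure (p z)) := by
  have := 𝒢.t2Space_units
  refine continuous_iff_continuousAt.2 fun z₀ => ?_
  obtain ⟨φ, hφ⟩ := exists_compactlySupported_extension (𝒢.isClosed_fiber (p z₀))
    (continuous_fiber_of_continuous hF z₀) hK (fun η hη => hFK z₀ η.1 η.2 hη)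
  have hK' : IsCompact (K ∪ tsupport φ) := hK.union φ.hasCompactSupport
  obtain ⟨ψ, hψ0, hψ1⟩ := exists_compactlySupported_eq_one hK'
  have hφc := (μ.continuous_integral φ).comp hp
  have hψc := ((μ.continuous_integral ψ).comp hp).norm
  -- Near `z₀` the mass `∫ ψ dλ^{p z}` stays below `C`; the added `1` leaves room for a strict bound
  -- and makes `C` positive.
  set C : ℝ := ‖∫ η : 𝒢.Fiber (p z₀), ψ η.1 ∂(μ.measure (p z₀))‖ + 1 with hC
  have hCpos : 0 < C := by positivity
  have hbd : ∀ᶠ z in 𝓝 z₀, ‖∫ η : 𝒢.Fiber (p z), ψ η.1 ∂(μ.measure (p z))‖ < C :=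
    (hψc.tendsto z₀).eventually_lt_const (lt_add_one _)
  have hint (z : Z) : Integrable (fun η : 𝒢.Fiber (p z) => F z η.1 η.2) (μ.measure (p z)) :=
    μ.integrable_fiber_of_compact (continuous_fiber_of_continuous hF z) hK
      fun η hη => hFK z η.1 η.2 hη
  have hdiff : Tendsto (fun z => (∫ η : 𝒢.Fiber (p z), F z η.1 η.2 ∂(μ.measure (p z))) -
      ∫ η : 𝒢.Fiber (p z), φ η.1 ∂(μ.measure (p z))) (𝓝 z₀) (𝓝 0) := by
    rw [Metric.tendsto_nhds]
    intro ε hε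
    have hloc : ∀ᶠ z in 𝓝 z₀, ∀ η ∈ K ∪ tsupport φ, ∀ h : 𝒢.r η = p z,
        ‖F z η h - φ η‖ < ε / C := by
      refine hK'.eventually_forall_of_forall_eventually fun η₀ _ => ?_
      -- On the fibre over `p z₀` the functions agree, so continuity applies. Off it, nearby pairs
      -- are not in the domain either, and the condition is vacuous.
      by_cases hη : 𝒢.r η₀ = p z₀
      · have hc : Continuous fun q : {q : Z × G // 𝒢.r q.2 = p q.1} =>
            ‖F q.1.1 q.1.2 q.2 - φ q.1.2‖ :=
          (hF.sub (φ.continuous.comp (continuous_snd.comp continuous_subtype_val))).norm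
        have h1 := (hc.tendsto ⟨(z₀, η₀), hη⟩).eventually_lt_const (u := ε / C)
          (by
            have := hφ ⟨η₀, hη⟩
            simp only at this
            simp only [this, sub_self, norm_zero]
            positivity)
        rw [nhds_subtype_eq_comap, eventually_comap] at h1
        filter_upwards [h1] with q hq h
        exact hq ⟨q, h⟩ rfl
      · have hc : IsOpen {q : Z × G | 𝒢.r q.2 ≠ p q.1} :=
          isOpen_ne_fun (𝒢.continuous_r.comp continuous_snd) (hp.comp continuous_fst)
        filter_upwards [hc.mem_nhds (x := (z₀, η₀)) hη] with q hq h
        exact absurd h hq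
    filter_upwards [hloc, hbd] with z hz hzb
    rw [dist_zero_right, ← integral_sub (hint z) (μ.integrable_fiber φ (p z))]
    have hψi := (μ.integrable_fiber ψ (p z)).re
    calc _ ≤ ∫ η : 𝒢.Fiber (p z), (ε / C) * (ψ η.1).re ∂(μ.measure (p z)) := by
          refine norm_integral_le_of_norm_le (hψi.const_mul _) (Eventually.of_forall fun η => ?_)
          by_cases hη : η.1 ∈ K ∪ tsupport φ
          · have := (hz η.1 hη η.2).le
            simpa [hψ1 _ hη] using this
          · rw [Set.mem_union, not_or] at hη
            rw [hFK z η.1 η.2 hη.1, image_eq_zero_of_notMem_tsupport hη.2, sub_self, norm_zero]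
            exact mul_nonneg (by positivity) (hψ0 _)
      _ = (ε / C) * (∫ η : 𝒢.Fiber (p z), ψ η.1 ∂(μ.measure (p z))).re := by
          rw [integral_const_mul]
          congr 1
          exact integral_re (μ.integrable_fiber ψ (p z))
      _ ≤ (ε / C) * ‖∫ η : 𝒢.Fiber (p z), ψ η.1 ∂(μ.measure (p z))‖ := by
          gcongr
          exact Complex.re_le_norm _
      _ < (ε / C) * C := by gcongr
      _ = ε := by field_simp
  have h0 : (∫ η : 𝒢.Fiber (p z₀), F z₀ η.1 η.2 ∂(μ.measure (p z₀))) =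
      ∫ η : 𝒢.Fiber (p z₀), φ η.1 ∂(μ.measure (p z₀)) := by
    refine integral_congr_ae (Eventually.of_forall fun η => (hφ η).symm)
  have h2 := hdiff.add (hφc.tendsto z₀)
  have h3 : Tendsto (fun z => ∫ η : 𝒢.Fiber (p z), F z η.1 η.2 ∂(μ.measure (p z))) (𝓝 z₀)
      (𝓝 (∫ η : 𝒢.Fiber (p z₀), φ η.1 ∂(μ.measure (p z₀)))) := by simpa using h2
  rw [← h0] at h3
  exact h3

variable {E : X → Type w} [∀ x, NormedAddCommGroup (E x)] [∀ x, InnerProductSpace ℂ (E x)]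
  [TopologicalSpace (TotalSpace ℂ E)] [IsHilbertBundle E]

theorem continuous_fiber_of_continuousAlong {F : ∀ (z : Z) (η : G), 𝒢.r η = p z → E (p z)}
    (hF : ContinuousAlong (fun q : {q : Z × G // 𝒢.r q.2 = p q.1} => p q.1.1)
      fun q => F q.1.1 q.1.2 q.2) (z : Z) :
    Continuous fun η : 𝒢.Fiber (p z) => F z η.1 η.2 :=
  ContinuousAlong.continuous_of_const (hF.comp
    ((continuous_const.prodMk continuous_subtype_val).subtype_mk
    (p := fun q : Z × G => 𝒢.r q.2 = p q.1) (fun η : 𝒢.Fiber (p z) => η.2)))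

/-- Reduction to scalar integrals: it is enough that `‖u - e(z)‖` is continuous in `z` and in `u ∈
E_{p(z)}`. Expanding the square leaves `‖u‖²`, the integral of `(u | F)`, and `‖e(z)‖²`, which is a
double integral of `(F | F)`. -/
theorem continuousAlong_integral_fiber (hp : Continuous p)
    {F : ∀ (z : Z) (η : G), 𝒢.r η = p z → E (p z)}
    (hF : ContinuousAlong (fun q : {q : Z × G // 𝒢.r q.2 = p q.1} => p q.1.1)
      fun q => F q.1.1 q.1.2 q.2)
    {K : Set G} (hK : IsCompact K) (hFK : ∀ z η h, η ∉ K → F z η h = 0) :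
    ContinuousAlong p fun z => ∫ η : 𝒢.Fiber (p z), F z η.1 η.2 ∂(μ.measure (p z)) := by
  have hcompl (x : X) : CompleteSpace (E x) := IsHilbertBundle.complete x
  have hint (z : Z) : Integrable (fun η : 𝒢.Fiber (p z) => F z η.1 η.2) (μ.measure (p z)) :=
    μ.integrable_fiber_of_compact (continuous_fiber_of_continuousAlong hF z) hK
      fun η hη => hFK z η.1 η.2 hη
  set e : ∀ z, E (p z) := fun z => ∫ η : 𝒢.Fiber (p z), F z η.1 η.2 ∂(μ.measure (p z)) with he
  have hnorm : Continuous fun z => inner ℂ (e z) (e z) := by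
    let Z₂ := {q : Z × G // 𝒢.r q.2 = p q.1}
    have hp₂ : Continuous fun q : Z₂ => p q.1.1 :=
      hp.comp (continuous_fst.comp continuous_subtype_val)
    -- Inner integral of the double integral: the scalar result is applied over the parameter space
    -- of pairs `(z, η)`, then again over `Z`.
    have h1 : Continuous fun q : Z₂ => ∫ τ : 𝒢.Fiber (p q.1.1),
        inner ℂ (F q.1.1 q.1.2 q.2) (F q.1.1 τ.1 τ.2) ∂(μ.measure (p q.1.1)) := by
      refine μ.continuous_integral_fiber (p := fun q : Z₂ => p q.1.1)
        (F := fun q τ h => inner ℂ (F q.1.1 q.1.2 q.2) (F q.1.1 τ h)) hp₂ ?_ hK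
        (fun q τ h hτ => by rw [hFK _ _ _ hτ, inner_zero_right])
      have c1 : Continuous fun t : {t : Z₂ × G // 𝒢.r t.2 = p t.1.1.1} => t.1.1 :=
        continuous_fst.comp continuous_subtype_val
      have c2 : Continuous fun t : {t : Z₂ × G // 𝒢.r t.2 = p t.1.1.1} =>
          (⟨(t.1.1.1.1, t.1.2), t.2⟩ : Z₂) :=
        ((continuous_fst.comp (continuous_subtype_val.comp c1)).prodMk
          (continuous_snd.comp continuous_subtype_val)).subtype_mk _
      exact (hF.comp c1).inner (hF.comp c2)
    have h2 : Continuous fun z => ∫ η : 𝒢.Fiber (p z),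
        (starRingEnd ℂ) (∫ τ : 𝒢.Fiber (p z), inner ℂ (F z η.1 η.2) (F z τ.1 τ.2)
          ∂(μ.measure (p z))) ∂(μ.measure (p z)) :=
      μ.continuous_integral_fiber (F := fun z η h => (starRingEnd ℂ) (∫ τ : 𝒢.Fiber (p z),
        inner ℂ (F z η h) (F z τ.1 τ.2) ∂(μ.measure (p z)))) hp
        (Complex.continuous_conj.comp h1) hK
        (fun z η h hη => by simp [hFK z η h hη])
    refine h2.congr fun z => ?_
    rw [← integral_inner (hint z) (e z)]
    refine integral_congr_ae (Eventually.of_forall fun η => ?_)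
    simp only
    rw [integral_inner (hint z), inner_conj_symm]
  refine ContinuousAlong.of_continuous_norm_sub hp ?_
  let W := {w : Z × TotalSpace ℂ E // w.2.proj = p w.1}
  have hq : Continuous fun w : W => w.1.1 := continuous_fst.comp continuous_subtype_val
  have hu : ContinuousAlong (fun w : W => p w.1.1) (fun w => fiberCast w.2 w.1.2.2) := by
    have h0 : Continuous fun w : W => w.1.2 := continuous_snd.comp continuous_subtype_val
    refine h0.congr fun w => (totalSpace_fiberCast w.2 w.1.2.2).symm
  have hin : Continuous fun w : W => inner ℂ (fiberCast w.2 w.1.2.2) (e w.1.1) := by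
    have h1 : Continuous fun w : W => ∫ η : 𝒢.Fiber (p w.1.1),
        inner ℂ (fiberCast w.2 w.1.2.2) (F w.1.1 η.1 η.2) ∂(μ.measure (p w.1.1)) := by
      refine μ.continuous_integral_fiber (p := fun w : W => p w.1.1)
        (F := fun w η h => inner ℂ (fiberCast w.2 w.1.2.2) (F w.1.1 η h)) (hp.comp hq) ?_ hK
        (fun w η h hη => by rw [hFK _ _ _ hη, inner_zero_right])
      have c1 : Continuous fun t : {t : W × G // 𝒢.r t.2 = p t.1.1.1} => t.1.1 :=
        continuous_fst.comp continuous_subtype_val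
      have c2 : Continuous fun t : {t : W × G // 𝒢.r t.2 = p t.1.1.1} =>
          (⟨(t.1.1.1.1, t.1.2), t.2⟩ : {q : Z × G // 𝒢.r q.2 = p q.1}) :=
        ((hq.comp c1).prodMk (continuous_snd.comp continuous_subtype_val)).subtype_mk _
      exact (hu.comp c1).inner (hF.comp c2)
    exact h1.congr fun w => integral_inner (hint w.1.1) _
  have hsq : Continuous fun w : W => ‖fiberCast w.2 w.1.2.2 - e w.1.1‖ ^ 2 := by
    have h1 := ((hu.norm.pow 2).sub
      ((continuous_const (y := (2 : ℝ))).mul (Complex.continuous_re.comp hin))).add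
      (Complex.continuous_re.comp (hnorm.comp hq))
    refine h1.congr fun w => ?_
    rw [@norm_sub_sq ℂ, norm_sq_eq_re_inner (𝕜 := ℂ) (e w.1.1)]
    rfl
  refine (Real.continuous_sqrt.comp hsq).congr fun w => ?_
  exact Real.sqrt_sq (norm_nonneg _)

end HaarSystem

/-! ## Convolution, module actions and inner product of compactly supported sections -/

section Convolution

variable {X : Type u} {G : Type v} [TopologicalSpace X] [TopologicalSpace G]
  [T2Space G] [LocallyCompactSpace G] [SecondCountableTopology G]
  [MeasurableSpace G] [BorelSpace G] {𝒢 : TopGroupoid X G} (μ : HaarSystem 𝒢)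
  {E : X → Type w} [∀ x, NormedAddCommGroup (E x)] [∀ x, InnerProductSpace ℂ (E x)]
  [TopologicalSpace (TotalSpace ℂ E)]

/-- The substitution `η = γη'` gives `η⁻¹γ = η'⁻¹`. All convolution-type products are now integrals
over `G^{r(γ)}`, so they can be added and their supports read off from `γ = η (η⁻¹γ)`. -/
theorem conv_eq_integral_ldiv (f g : G → ℂ) (γ : G) :
    conv μ f g γ =
      ∫ η : 𝒢.Fiber (𝒢.r γ), f η.1 * g (𝒢.ldiv η.1 γ η.2) ∂(μ.measure (𝒢.r γ)) := by
  rw [μ.integral_translate γ rfl rfl (fun η h => f η * g (𝒢.ldiv η γ h))]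
  refine integral_congr_ae (Eventually.of_forall fun η => ?_)
  simp only [𝒢.ldiv_mul_self_right]

theorem rightAction_eq_integral_ldiv (ξ : ∀ γ : G, E (𝒢.r γ)) (g : G → ℂ) (γ : G) :
    rightAction μ ξ g γ =
      ∫ η : 𝒢.Fiber (𝒢.r γ), g (𝒢.ldiv η.1 γ η.2) • secAt ξ η.1 η.2 ∂(μ.measure (𝒢.r γ)) := by
  rw [μ.integral_translate γ rfl rfl (fun η h => g (𝒢.ldiv η γ h) • secAt ξ η h)]
  refine integral_congr_ae (Eventually.of_forall fun η => ?_)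
  simp only [𝒢.ldiv_mul_self_right]

theorem TopGroupoid.continuous_ldiv_subtype (𝒢 : TopGroupoid X G) :
    Continuous fun q : {q : G × G // 𝒢.r q.2 = 𝒢.r q.1} => 𝒢.ldiv q.1.2 q.1.1 q.2 :=
  𝒢.continuous_ldiv_comp (continuous_snd.comp continuous_subtype_val)
    (continuous_fst.comp continuous_subtype_val) _

theorem TopGroupoid.mem_mulSet_of_ldiv (𝒢 : TopGroupoid X G) {A B : Set G} {a b : G} (ha : a ∈ A)
    (h : 𝒢.r a = 𝒢.r b) (hb : 𝒢.ldiv a b h ∈ B) : b ∈ 𝒢.mulSet A B := by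
  have := 𝒢.mul_mem_mulSet ha hb (𝒢.r_ldiv a b h).symm
  rwa [𝒢.mul_ldiv] at this

/-- Convolution as an operation on `C_c(G)`. -/
noncomputable def convCc (f g : C_c(G, ℂ)) : C_c(G, ℂ) where
  toFun := conv μ f g
  continuous_toFun := by
    simp_rw [funext (conv_eq_integral_ldiv μ f g)]
    refine μ.continuous_integral_fiber (F := fun γ η h => f η * g (𝒢.ldiv η γ h)) 𝒢.continuous_r
      ((f.continuous.comp (continuous_snd.comp continuous_subtype_val)).mul
        (g.continuous.comp 𝒢.continuous_ldiv_subtype)) f.hasCompactSupport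
      (fun γ η h hη => by simp [image_eq_zero_of_notMem_tsupport hη])
  hasCompactSupport' := by
    refine HasCompactSupport.intro
      (𝒢.isCompact_mulSet f.hasCompactSupport g.hasCompactSupport) fun γ hγ => ?_
    rw [conv_eq_integral_ldiv]
    refine integral_eq_zero_of_ae (Eventually.of_forall fun η => ?_)
    by_contra hne
    obtain ⟨hf, hg⟩ := ne_zero_and_ne_zero_of_mul hne
    exact hγ (𝒢.mem_mulSet_of_ldiv (subset_tsupport f hf) η.2 (subset_tsupport g hg))

@[simp] theorem convCc_apply (f g : C_c(G, ℂ)) (γ : G) : convCc μ f g γ = conv μ f g γ := rfl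

variable [IsHilbertBundle E]

theorem continuousAlong_leftAction_integrand (L : GroupoidAction 𝒢 E) (f : C_c(G, ℂ))
    (ξ : CcSections 𝒢 E) :
    ContinuousAlong (fun q : {q : G × G // 𝒢.r q.2 = 𝒢.r q.1} => 𝒢.r q.1.1) fun q =>
      f q.1.2 • L.act q.1.2 rfl q.2 (secAt ξ.1 (𝒢.ldiv q.1.2 q.1.1 q.2) (𝒢.r_ldiv _ _ _)) :=
  have h2 : Continuous fun q : {q : G × G // 𝒢.r q.2 = 𝒢.r q.1} => q.1.2 :=
    continuous_snd.comp continuous_subtype_val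
  (L.continuousAlong_act h2 (fun _ => rfl) (fun q => q.2)
    (ξ.2.1.secAt_along 𝒢.continuous_ldiv_subtype _)).smul (f.continuous.comp h2)

/-- The left action of `C_c(G)` on `C_c(G, r^*E)`. -/
noncomputable def leftActionCc (L : GroupoidAction 𝒢 E) (f : C_c(G, ℂ)) (ξ : CcSections 𝒢 E) :
    CcSections 𝒢 E := by
  refine ⟨leftAction μ L f ξ.1, ?_, ?_⟩
  · exact μ.continuousAlong_integral_fiber (F := fun γ η h => f η • L.act η rfl h
      (secAt ξ.1 (𝒢.ldiv η γ h) (𝒢.r_ldiv _ _ _))) 𝒢.continuous_r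
      (continuousAlong_leftAction_integrand L f ξ) f.hasCompactSupport
      (fun γ η h hη => by simp [image_eq_zero_of_notMem_tsupport hη])
  · obtain ⟨K, hK, hξK⟩ := ξ.2.2
    refine ⟨_, 𝒢.isCompact_mulSet f.hasCompactSupport hK, fun γ hγ => ?_⟩
    refine integral_eq_zero_of_ae (Eventually.of_forall fun η => ?_)
    by_contra hne
    have hf : f η.1 ≠ 0 := fun h0 => hne (by simp [h0])
    refine hγ (𝒢.mem_mulSet_of_ldiv (subset_tsupport f hf) η.2 ?_)
    by_contra hK
    refine hne ?_
    change f η.1 • L.act η.1 rfl η.2 (secAt ξ.1 (𝒢.ldiv η.1 γ η.2) (𝒢.r_ldiv _ _ _)) = 0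
    rw [secAt_eq_zero _ (hξK _ hK), map_zero, smul_zero]

theorem continuousAlong_rightAction_integrand (ξ : CcSections 𝒢 E) (g : C_c(G, ℂ)) :
    ContinuousAlong (fun q : {q : G × G // 𝒢.r q.2 = 𝒢.r q.1} => 𝒢.r q.1.1) fun q =>
      g (𝒢.ldiv q.1.2 q.1.1 q.2) • secAt ξ.1 q.1.2 q.2 :=
  have h2 : Continuous fun q : {q : G × G // 𝒢.r q.2 = 𝒢.r q.1} => q.1.2 :=
    continuous_snd.comp continuous_subtype_val
  (ξ.2.1.secAt_along h2 (fun q => q.2)).smul (g.continuous.comp 𝒢.continuous_ldiv_subtype)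

/-- The right action of `C_c(G)` on `C_c(G, r^*E)`. -/
noncomputable def rightActionCc (ξ : CcSections 𝒢 E) (g : C_c(G, ℂ)) : CcSections 𝒢 E := by
  refine ⟨rightAction μ ξ.1 g, ?_, ?_⟩
  · rw [funext (rightAction_eq_integral_ldiv μ ξ.1 g)]
    exact μ.continuousAlong_integral_fiber (F := fun γ η h => g (𝒢.ldiv η γ h) • secAt ξ.1 η h)
      𝒢.continuous_r (continuousAlong_rightAction_integrand ξ g) ξ.2.2.choose_spec.1
      (fun γ η h hη => by rw [secAt_eq_zero h (ξ.2.2.choose_spec.2 η hη), smul_zero])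
  · obtain ⟨K, hK, hξK⟩ := ξ.2.2
    refine ⟨_, 𝒢.isCompact_mulSet hK g.hasCompactSupport, fun γ hγ => ?_⟩
    rw [rightAction_eq_integral_ldiv]
    refine integral_eq_zero_of_ae (Eventually.of_forall fun η => ?_)
    by_contra hne
    have hg : g (𝒢.ldiv η.1 γ η.2) ≠ 0 := fun h0 => hne (by simp [h0])
    refine hγ (𝒢.mem_mulSet_of_ldiv ?_ η.2 (subset_tsupport g hg))
    by_contra hK
    refine hne ?_
    change g (𝒢.ldiv η.1 γ η.2) • secAt ξ.1 η.1 η.2 = 0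
    rw [secAt_eq_zero η.2 (hξK _ hK), smul_zero]

/-- The `C_c(G)`-valued inner product on `C_c(G, r^*E)`. -/
noncomputable def innerProdCc (ξ ζ : CcSections 𝒢 E) : C_c(G, ℂ) where
  toFun := innerProd μ ξ.1 ζ.1
  continuous_toFun := by
    have h2 : Continuous fun q : {q : G × G // 𝒢.r q.2 = 𝒢.r q.1} => q.1.2 :=
      continuous_snd.comp continuous_subtype_val
    obtain ⟨K, hK, hξK⟩ := ξ.2.2
    refine μ.continuous_integral_fiber (F := fun γ τ h => inner ℂ
      (secAt ξ.1 (𝒢.inv τ) (𝒢.r_inv τ)) (secAt ζ.1 (𝒢.ldiv τ γ h) (𝒢.r_ldiv _ _ _)))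
      𝒢.continuous_r ((ξ.2.1.secAt_along (𝒢.continuous_inv.comp h2) _).inner
        (ζ.2.1.secAt_along 𝒢.continuous_ldiv_subtype _)) (hK.image 𝒢.continuous_inv) ?_
    intro γ τ h hτ
    rw [secAt_eq_zero _ (hξK _ fun h' => hτ ⟨_, h', 𝒢.inv_inv τ⟩), inner_zero_left]
  hasCompactSupport' := by
    obtain ⟨K, hK, hξK⟩ := ξ.2.2
    obtain ⟨K', hK', hζK⟩ := ζ.2.2
    refine HasCompactSupport.intro
      (𝒢.isCompact_mulSet (hK.image 𝒢.continuous_inv) hK') fun γ hγ => ?_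
    refine integral_eq_zero_of_ae (Eventually.of_forall fun τ => ?_)
    change inner ℂ (secAt ξ.1 (𝒢.inv τ.1) (𝒢.r_inv τ.1))
      (secAt ζ.1 (𝒢.ldiv τ.1 γ τ.2) (𝒢.r_ldiv _ _ _)) = 0
    by_cases h1 : 𝒢.inv τ.1 ∈ K
    · by_cases h2 : 𝒢.ldiv τ.1 γ τ.2 ∈ K'
      · have h3 : τ.1 ∈ 𝒢.inv '' K := ⟨_, h1, 𝒢.inv_inv τ.1⟩
        exact absurd (𝒢.mem_mulSet_of_ldiv h3 τ.2 h2) hγ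
      · rw [secAt_eq_zero _ (hζK _ h2), inner_zero_right]
    · rw [secAt_eq_zero _ (hξK _ h1), inner_zero_left]

@[simp] theorem innerProdCc_apply (ξ ζ : CcSections 𝒢 E) (γ : G) :
    innerProdCc μ ξ ζ γ = innerProd μ ξ.1 ζ.1 γ := rfl

/-! ## The Leibniz rule -/

theorem IsContinuousCocycle.secAt_mul {L : GroupoidAction 𝒢 E} {c : ∀ γ : G, E (𝒢.r γ)}
    (hc : IsContinuousCocycle L c) {x y : X} (a b : G) (h : 𝒢.s a = 𝒢.r b) (ha : 𝒢.r a = x)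
    (hb : 𝒢.r b = y) :
    secAt c (𝒢.mul a b h) ((𝒢.r_mul a b h).trans ha) =
      secAt c a ha + L.act a (h.trans hb) ha (secAt c b hb) := by
  subst ha
  have key : ∀ (y : X) (e : 𝒢.r b = y) (e' : 𝒢.s a = y),
      L.act a rfl rfl (secAt c b h.symm) = L.act a e' rfl (secAt c b e) := by
    rintro y e rfl; rfl
  rw [hc.cocycle a b h, key y hb (h.trans hb)]
  rfl

theorem secAt_cocycleDerivation {c : ∀ γ : G, E (𝒢.r γ)} (hc : ContinuousSection c)
    (f : C_c(G, ℂ)) {x : X} (γ : G) (h : 𝒢.r γ = x) :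
    secAt (cocycleDerivation c hc f).1 γ h = (Complex.I * f γ) • secAt c γ h := by
  subst h; rfl

/-- Insert `c(γ) = c(η) + L(η) c(η⁻¹γ)` into `∫ i f(η) g(η⁻¹γ) c(γ)`. The first summand integrates
to `∂(f) g`, the second to `f ∂(g)`. -/
theorem cocycleDerivation_convCc {L : GroupoidAction 𝒢 E} {c : ∀ γ : G, E (𝒢.r γ)}
    (hc : IsContinuousCocycle L c) (f g : C_c(G, ℂ)) :
    cocycleDerivation c hc.continuous (convCc μ f g) =
      leftActionCc μ L f (cocycleDerivation c hc.continuous g) +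
        rightActionCc μ (cocycleDerivation c hc.continuous f) g := by
  set δ := cocycleDerivation c hc.continuous
  ext γ
  obtain ⟨K, hK, hδK⟩ := (δ f).2.2
  have i1 : Integrable (fun η : 𝒢.Fiber (𝒢.r γ) => f η.1 • L.act η.1 rfl η.2
      (secAt (δ g).1 (𝒢.ldiv η.1 γ η.2) (𝒢.r_ldiv _ _ _))) (μ.measure (𝒢.r γ)) :=
    μ.integrable_fiber_of_compact (HaarSystem.continuous_fiber_of_continuousAlong
      (F := fun γ η h => f η • L.act η rfl h (secAt (δ g).1 (𝒢.ldiv η γ h) (𝒢.r_ldiv _ _ _)))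
      (continuousAlong_leftAction_integrand L f (δ g)) γ) f.hasCompactSupport
      (fun η hη => by simp [image_eq_zero_of_notMem_tsupport hη])
  have i2 : Integrable (fun η : 𝒢.Fiber (𝒢.r γ) =>
      g (𝒢.ldiv η.1 γ η.2) • secAt (δ f).1 η.1 η.2) (μ.measure (𝒢.r γ)) :=
    μ.integrable_fiber_of_compact (HaarSystem.continuous_fiber_of_continuousAlong
      (F := fun γ η h => g (𝒢.ldiv η γ h) • secAt (δ f).1 η h)
      (continuousAlong_rightAction_integrand (δ f) g) γ) hK
      (fun η hη => by rw [secAt_eq_zero η.2 (hδK _ hη), smul_zero])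
  change (Complex.I * conv μ f g γ) • c γ = leftAction μ L f (δ g).1 γ +
    rightAction μ (δ f).1 g γ
  have e1 : leftAction μ L f (δ g).1 γ = ∫ η : 𝒢.Fiber (𝒢.r γ), f η.1 • L.act η.1 rfl η.2
      (secAt (δ g).1 (𝒢.ldiv η.1 γ η.2) (𝒢.r_ldiv _ _ _)) ∂(μ.measure (𝒢.r γ)) := rfl
  have hcompl : CompleteSpace (E (𝒢.r γ)) := IsHilbertBundle.complete _
  rw [e1, rightAction_eq_integral_ldiv, ← integral_add i1 i2, conv_eq_integral_ldiv,
    ← integral_const_mul, ← integral_smul_const]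
  refine integral_congr_ae (Eventually.of_forall fun η => ?_)
  have hcoc := hc.secAt_mul η.1 (𝒢.ldiv η.1 γ η.2) (𝒢.r_ldiv _ _ _).symm η.2 (𝒢.r_ldiv _ _ _)
  rw [secAt_congr c (𝒢.mul_ldiv η.1 γ η.2), secAt_rfl] at hcoc
  simp only [δ, secAt_cocycleDerivation, map_smul, hcoc, smul_add, smul_smul]
  rw [add_comm]
  congr 2 <;> ring

/-- The Leibniz rule already holds between compactly supported sections, so any linear `j` preserves
it; this serves the full and the reduced completion alike. -/
theorem isDerivation_cocycleDerivation {L : GroupoidAction 𝒢 E} {c : ∀ γ : G, E (𝒢.r γ)}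
    (hc : IsContinuousCocycle L c) {𝓜 : Type*} [AddCommGroup 𝓜] [Module ℂ 𝓜]
    (j : CcSections 𝒢 E →ₗ[ℂ] 𝓜) : IsDerivation μ L j (cocycleDerivation c hc.continuous) :=
  fun f g => ⟨convCc μ f g, leftActionCc μ L f (cocycleDerivation c hc.continuous g),
    rightActionCc μ (cocycleDerivation c hc.continuous f) g, fun _ => rfl, fun _ => rfl,
    fun _ => rfl, by rw [cocycleDerivation_convCc μ hc, map_add]⟩

end Convolution

/-! ## The regular representation on the fibres -/

/-- Schur's test: Cauchy–Schwarz after writing `k a = k^{1/2} (k^{1/2} a)`, then Tonelli. Row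
integrals contribute `C`, column integrals `D`. -/
theorem lintegral_schur_test {Y : Type*} [MeasurableSpace Y] {m : Measure Y} [SFinite m]
    {k : Y → Y → ℝ≥0∞} (hk : Measurable (Function.uncurry k)) {a : Y → ℝ≥0∞} (ha : Measurable a)
    {C D : ℝ≥0∞} (h1 : ∀ ζ, ∫⁻ η, k ζ η ∂m ≤ C) (h2 : ∀ η, ∫⁻ ζ, k ζ η ∂m ≤ D) :
    ∫⁻ ζ, (∫⁻ η, k ζ η * a η ∂m) ^ (2 : ℝ) ∂m ≤ C * (D * ∫⁻ η, a η ^ (2 : ℝ) ∂m) := by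
  have hkζ (ζ : Y) : Measurable (k ζ) := hk.comp measurable_prodMk_left
  have hpt (ζ : Y) : (∫⁻ η, k ζ η * a η ∂m) ^ (2 : ℝ) ≤
      C * ∫⁻ η, k ζ η * a η ^ (2 : ℝ) ∂m := by
    have hF : Measurable fun η => k ζ η ^ (1 / 2 : ℝ) := (hkζ ζ).pow_const _
    have hH := ENNReal.lintegral_mul_le_Lp_mul_Lq m (p := 2) (q := 2)
      (Real.HolderConjugate.two_two) hF.aemeasurable (hF.mul ha).aemeasurable
    have e0 (t : ℝ≥0∞) : (t ^ (1 / 2 : ℝ)) ^ (2 : ℝ) = t := by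
      rw [← ENNReal.rpow_mul]; norm_num
    have e1 (η : Y) : k ζ η ^ (1 / 2 : ℝ) * (k ζ η ^ (1 / 2 : ℝ) * a η) = k ζ η * a η := by
      rw [← mul_assoc, ← ENNReal.rpow_add_of_nonneg _ _ (by norm_num) (by norm_num)]
      norm_num
    simp only [Pi.mul_apply, e0, e1, ENNReal.mul_rpow_of_nonneg _ _ (zero_le_two (α := ℝ))] at hH
    calc (∫⁻ η, k ζ η * a η ∂m) ^ (2 : ℝ) ≤ _ := ENNReal.rpow_le_rpow hH zero_le_two
      _ = (∫⁻ η, k ζ η ∂m) * ∫⁻ η, k ζ η * a η ^ (2 : ℝ) ∂m := by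
          rw [ENNReal.mul_rpow_of_nonneg _ _ zero_le_two, e0, e0]
      _ ≤ _ := by gcongr; exact h1 ζ
  have hka : Measurable (Function.uncurry fun ζ η => k ζ η * a η ^ (2 : ℝ)) :=
    hk.mul ((ha.pow_const _).comp measurable_snd)
  calc _ ≤ ∫⁻ ζ, C * ∫⁻ η, k ζ η * a η ^ (2 : ℝ) ∂m ∂m := lintegral_mono hpt
    _ = C * ∫⁻ ζ, ∫⁻ η, k ζ η * a η ^ (2 : ℝ) ∂m ∂m :=
        lintegral_const_mul _ hka.lintegral_prod_right
    _ = C * ∫⁻ η, ∫⁻ ζ, k ζ η * a η ^ (2 : ℝ) ∂m ∂m := by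
        rw [lintegral_lintegral_swap hka.aemeasurable]
    _ = C * ∫⁻ η, (∫⁻ ζ, k ζ η ∂m) * a η ^ (2 : ℝ) ∂m := by
        congr 1
        refine lintegral_congr fun η => ?_
        exact lintegral_mul_const _ (hk.comp measurable_prodMk_right)
    _ ≤ C * ∫⁻ η, D * a η ^ (2 : ℝ) ∂m := by
        gcongr with η
        exact h2 η
    _ = _ := by rw [lintegral_const_mul _ (ha.pow_const _)]

theorem integral_inner_right {Y : Type*} [MeasurableSpace Y] {m : Measure Y} {H : Type*}
    [NormedAddCommGroup H] [InnerProductSpace ℂ H] [CompleteSpace H] {v : Y → H}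
    (hv : Integrable v m) (b : H) : ∫ y, inner ℂ (v y) b ∂m = inner ℂ (∫ y, v y ∂m) b := by
  rw [← inner_conj_symm (∫ y, v y ∂m) b, ← integral_inner hv b, ← integral_conj]
  simp only [inner_conj_symm]

/-- This is `⟨a, T^*T b⟩ = ⟨T a, T b⟩` for the operator `T` with kernel `Φ`, by two applications of
Fubini for compactly supported continuous functions. The set `S` bounds `τ` in both: outside it `b
Φ_τ` vanishes, hence so does `T b`, and no such bound is needed for `a`. -/
theorem integral_inner_kernel {Y : Type*} [TopologicalSpace Y] [T2Space Y] [MeasurableSpace Y]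
    [BorelSpace Y] {m : Measure Y} [IsFiniteMeasureOnCompacts m] {H : Type*}
    [NormedAddCommGroup H] [InnerProductSpace ℂ H] [CompleteSpace H] {Φ : Y → Y → H}
    (hΦ : Continuous (Function.uncurry Φ)) {a b : Y → ℂ} (ha : Continuous a) (hb : Continuous b)
    (ha' : HasCompactSupport a) (hb' : HasCompactSupport b) {S : Set Y} (hS : IsCompact S)
    (hSb : ∀ τ η, τ ∉ S → b η • Φ τ η = 0)
    (hT : Continuous fun τ => ∫ η, b η • Φ τ η ∂m) :
    ∫ ζ, (starRingEnd ℂ) (a ζ) * (∫ η, (∫ τ, inner ℂ (Φ τ ζ) (Φ τ η) ∂m) * b η ∂m) ∂m =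
      ∫ τ, inner ℂ (∫ ζ, a ζ • Φ τ ζ ∂m) (∫ η, b η • Φ τ η ∂m) ∂m := by
  have hΦτ (τ : Y) : Continuous (Φ τ) := hΦ.comp (Continuous.prodMk_right τ)
  have hia (τ : Y) : Integrable (fun ζ => a ζ • Φ τ ζ) m :=
    (ha.smul (hΦτ τ)).integrable_of_hasCompactSupport ha'.smul_right
  have hib (τ : Y) : Integrable (fun ζ => b ζ • Φ τ ζ) m :=
    (hb.smul (hΦτ τ)).integrable_of_hasCompactSupport hb'.smul_right
  have hT0 (τ : Y) (hτ : τ ∉ S) : ∫ η, b η • Φ τ η ∂m = 0 := by simp [hSb τ _ hτ]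
  have h1 (ζ : Y) : ∫ η, (∫ τ, inner ℂ (Φ τ ζ) (Φ τ η) ∂m) * b η ∂m =
      ∫ τ, inner ℂ (Φ τ ζ) (∫ η, b η • Φ τ η ∂m) ∂m := by
    have hsw := integral_integral_swap_of_hasCompactSupport (μ := m) (ν := m)
      (f := fun η τ => inner ℂ (Φ τ ζ) (b η • Φ τ η)) ?_ ?_
    · simp_rw [integral_inner (hib _)] at hsw
      rw [← hsw]
      refine integral_congr_ae (Eventually.of_forall fun η => ?_)
      simp only [inner_smul_right]
      rw [integral_const_mul, mul_comm]
    · exact (hΦ.comp (continuous_snd.prodMk continuous_const)).inner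
        ((hb.comp continuous_fst).smul (hΦ.comp continuous_swap))
    · refine HasCompactSupport.intro (hb'.isCompact.prod hS) ?_
      rintro ⟨η, τ⟩ hητ
      simp only [Function.uncurry_apply_pair]
      by_cases hτ : τ ∈ S
      · have hη : η ∉ tsupport b := fun h => hητ ⟨h, hτ⟩
        rw [image_eq_zero_of_notMem_tsupport hη, zero_smul, inner_zero_right]
      · rw [hSb τ η hτ, inner_zero_right]
  have hsw := integral_integral_swap_of_hasCompactSupport (μ := m) (ν := m)
    (f := fun ζ τ => inner ℂ (a ζ • Φ τ ζ) (∫ η, b η • Φ τ η ∂m)) ?_ ?_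
  · simp_rw [integral_inner_right (hia _)] at hsw
    rw [← hsw]
    refine integral_congr_ae (Eventually.of_forall fun ζ => ?_)
    simp only [h1, inner_smul_left]
    rw [integral_const_mul]
  · exact ((ha.comp continuous_fst).smul (hΦ.comp continuous_swap)).inner
      (hT.comp continuous_snd)
  · refine HasCompactSupport.intro (ha'.isCompact.prod hS) ?_
    rintro ⟨ζ, τ⟩ hζτ
    simp only [Function.uncurry_apply_pair]
    by_cases hτ : τ ∈ S
    · have hζ : ζ ∉ tsupport a := fun h => hζτ ⟨h, hτ⟩
      rw [image_eq_zero_of_notMem_tsupport hζ, zero_smul, inner_zero_left]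
    · rw [hT0 τ hτ, inner_zero_right]

section Regular

variable {X : Type u} {G : Type v} [TopologicalSpace X] [TopologicalSpace G]
  [T2Space G] [LocallyCompactSpace G] [SecondCountableTopology G]
  [MeasurableSpace G] [BorelSpace G] {𝒢 : TopGroupoid X G} (μ : HaarSystem 𝒢)

namespace TopGroupoid

variable (𝒢) in
/-- The product `ζ⁻¹ η` of two elements of a range fibre. -/
def fiberLdiv {x : X} (ζ η : 𝒢.Fiber x) : G := 𝒢.ldiv ζ.1 η.1 (ζ.2.trans η.2.symm)

theorem r_fiberLdiv {x : X} (ζ η : 𝒢.Fiber x) : 𝒢.r (𝒢.fiberLdiv ζ η) = 𝒢.s ζ.1 :=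
  𝒢.r_ldiv _ _ _

theorem continuous_fiberLdiv (x : X) :
    Continuous fun q : 𝒢.Fiber x × 𝒢.Fiber x => 𝒢.fiberLdiv q.1 q.2 :=
  𝒢.continuous_ldiv_comp (continuous_subtype_val.comp continuous_fst)
    (continuous_subtype_val.comp continuous_snd) _

theorem inv_fiberLdiv {x : X} (ζ η : 𝒢.Fiber x) :
    𝒢.inv (𝒢.fiberLdiv ζ η) = 𝒢.fiberLdiv η ζ := 𝒢.inv_ldiv _ _ _

theorem continuous_inv_fiber (x : X) : Continuous fun η : 𝒢.Fiber x => 𝒢.inv η.1 :=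
  𝒢.continuous_inv.comp continuous_subtype_val

theorem hasCompactSupport_inv_fiber (g : C_c(G, ℂ)) (x : X) :
    HasCompactSupport fun η : 𝒢.Fiber x => g (𝒢.inv η.1) :=
  HasCompactSupport.intro
    (𝒢.isCompact_fiber_preimage x (g.hasCompactSupport.isCompact.image 𝒢.continuous_inv))
    fun _ hη => image_eq_zero_of_notMem_tsupport fun h => hη ⟨_, h, 𝒢.inv_inv _⟩

end TopGroupoid

/-- Inversion turns the left regular representation on `G_x` into the operator on `G^x` with kernel
`f(ζ⁻¹η)`. -/
theorem conv_inv_fiber (f g : G → ℂ) {x : X} (ζ : 𝒢.Fiber x) :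
    conv μ f g (𝒢.inv ζ.1) =
      ∫ η : 𝒢.Fiber x, f (𝒢.fiberLdiv ζ η) * g (𝒢.inv η.1) ∂(μ.measure x) :=
  μ.integral_congr_base ((𝒢.s_inv ζ.1).trans ζ.2)
    (fun η h => f (𝒢.mul (𝒢.inv ζ.1) η h.symm) * g (𝒢.inv η))

/-- The function `x ↦ ∫ |f| dλ^x` is continuous and vanishes off the compact set `r(supp f)`. -/
theorem exists_lintegral_fiber_le (f : C_c(G, ℂ)) :
    ∃ C : ℝ, ∀ x, ∫⁻ η : 𝒢.Fiber x, ‖f η.1‖ₑ ∂(μ.measure x) ≤ ENNReal.ofReal C := by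
  have := 𝒢.t2Space_units
  let ψ : C_c(G, ℂ) := ⟨⟨fun γ => (‖f γ‖ : ℂ), by fun_prop⟩,
    f.hasCompactSupport.comp_left (g := fun z : ℂ => ((‖z‖ : ℝ) : ℂ)) (by simp)⟩
  obtain ⟨C, hC⟩ := (μ.continuous_integral ψ).bounded_above_of_compact_support
    (HasCompactSupport.intro (f.hasCompactSupport.isCompact.image 𝒢.continuous_r) fun x hx => by
      refine integral_eq_zero_of_ae (Eventually.of_forall fun η => ?_)
      have hη : η.1 ∉ tsupport f := fun h => hx ⟨_, h, η.2⟩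
      simp [ψ, image_eq_zero_of_notMem_tsupport hη])
  refine ⟨C, fun x => ?_⟩
  rw [← ofReal_integral_norm_eq_lintegral_enorm (μ.integrable_fiber f x)]
  refine ENNReal.ofReal_le_ofReal (le_trans ?_ (hC x))
  have e : ∫ η : 𝒢.Fiber x, ψ η.1 ∂(μ.measure x) =
      ((∫ η : 𝒢.Fiber x, ‖f η.1‖ ∂(μ.measure x) : ℝ) : ℂ) := integral_ofReal
  rw [e, Complex.norm_real]
  exact Real.le_norm_self _

theorem sourceL2Norm_sq (x : X) (h : G → ℂ) :
    sourceL2Norm μ x h ^ (2 : ℝ) =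
      ∫⁻ η : 𝒢.Fiber x, ‖h (𝒢.inv η.1)‖ₑ ^ (2 : ℝ) ∂(μ.measure x) := by
  have := eLpNorm_nnreal_pow_eq_lintegral (μ := μ.measure x) (p := 2)
    (f := fun η : 𝒢.Fiber x => h (𝒢.inv η.1)) two_ne_zero
  simpa [sourceL2Norm] using this

/-- The function `γ ↦ f(γ⁻¹)`. -/
noncomputable def invCc (𝒢 : TopGroupoid X G) (f : C_c(G, ℂ)) : C_c(G, ℂ) where
  toFun γ := f (𝒢.inv γ)
  continuous_toFun := f.continuous.comp 𝒢.continuous_inv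
  hasCompactSupport' :=
    HasCompactSupport.intro (f.hasCompactSupport.isCompact.image 𝒢.continuous_inv) fun _ hγ =>
      image_eq_zero_of_notMem_tsupport (f := f) fun h => hγ ⟨_, h, 𝒢.inv_inv _⟩

@[simp] theorem invCc_apply (f : C_c(G, ℂ)) (γ : G) : invCc 𝒢 f γ = f (𝒢.inv γ) := rfl

/-- The reduced norm is finite on `C_c(G)`. -/
theorem reducedNorm_lt_top (f : C_c(G, ℂ)) : reducedNorm μ f < ∞ := by
  obtain ⟨C, hC⟩ := exists_lintegral_fiber_le μ f
  obtain ⟨D, hD⟩ := exists_lintegral_fiber_le μ (invCc 𝒢 f)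
  have hfin : (ENNReal.ofReal C * ENNReal.ofReal D) ^ (1 / 2 : ℝ) < ∞ :=
    ENNReal.rpow_lt_top_of_nonneg (by norm_num) (by finiteness)
  refine lt_of_le_of_lt (iSup_le fun x => iSup_le fun g => iSup_le fun hg => ?_) hfin
  rw [one_div, ENNReal.le_rpow_inv_iff zero_lt_two, sourceL2Norm_sq]
  have hmeas : Measurable (Function.uncurry fun ζ η : 𝒢.Fiber x => ‖f (𝒢.fiberLdiv ζ η)‖ₑ) :=
    (f.continuous.comp (TopGroupoid.continuous_fiberLdiv x)).enorm.measurable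
  -- Translating by `ζ` turns a row integral of the kernel into `∫ |f| dλ^{s(ζ)}`; in `h2`,
  -- translating by `η` turns a column integral into that of `|f|` composed with inversion.
  have h1 (ζ : 𝒢.Fiber x) : ∫⁻ η : 𝒢.Fiber x, ‖f (𝒢.fiberLdiv ζ η)‖ₑ ∂(μ.measure x) ≤
      ENNReal.ofReal C := by
    refine le_of_eq_of_le ?_ (hC (𝒢.s ζ.1))
    refine (μ.lintegral_translate ζ.1 rfl ζ.2
      (fun η h => ‖f (𝒢.ldiv ζ.1 η (ζ.2.trans h.symm))‖ₑ)).trans ?_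
    simp only [𝒢.ldiv_mul_self_left]
  have h2 (η : 𝒢.Fiber x) : ∫⁻ ζ : 𝒢.Fiber x, ‖f (𝒢.fiberLdiv ζ η)‖ₑ ∂(μ.measure x) ≤
      ENNReal.ofReal D := by
    refine le_of_eq_of_le ?_ (hD (𝒢.s η.1))
    refine (μ.lintegral_translate η.1 rfl η.2
      (fun ζ h => ‖f (𝒢.ldiv ζ η.1 (h.trans η.2.symm))‖ₑ)).trans ?_
    simp only [𝒢.ldiv_mul_self_right]
    rfl
  calc ∫⁻ ζ : 𝒢.Fiber x, ‖conv μ f g (𝒢.inv ζ.1)‖ₑ ^ (2 : ℝ) ∂(μ.measure x)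
      ≤ ∫⁻ ζ : 𝒢.Fiber x, (∫⁻ η : 𝒢.Fiber x, ‖f (𝒢.fiberLdiv ζ η)‖ₑ * ‖g (𝒢.inv η.1)‖ₑ
          ∂(μ.measure x)) ^ (2 : ℝ) ∂(μ.measure x) := by
        refine lintegral_mono fun ζ => ENNReal.rpow_le_rpow ?_ zero_le_two
        rw [conv_inv_fiber]
        refine (enorm_integral_le_lintegral_enorm _).trans_eq ?_
        simp only [enorm_mul]
    _ ≤ ENNReal.ofReal C * (ENNReal.ofReal D *
          ∫⁻ η : 𝒢.Fiber x, ‖g (𝒢.inv η.1)‖ₑ ^ (2 : ℝ) ∂(μ.measure x)) :=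
        lintegral_schur_test hmeas
          (g.continuous.comp (TopGroupoid.continuous_inv_fiber x)).enorm.measurable h1 h2
    _ ≤ ENNReal.ofReal C * (ENNReal.ofReal D * 1) := by
        gcongr
        rw [← sourceL2Norm_sq]
        exact ENNReal.rpow_le_one hg zero_le_two
    _ = _ := by rw [mul_one]

theorem memLp_inv_fiber (g : C_c(G, ℂ)) (x : X) :
    MemLp (fun η : 𝒢.Fiber x => g (𝒢.inv η.1)) 2 (μ.measure x) :=
  (g.continuous.comp (TopGroupoid.continuous_inv_fiber x)).memLp_of_hasCompactSupport
    (TopGroupoid.hasCompactSupport_inv_fiber g x)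

/-- The restriction map `C_c(G) → L²(G_x, λ_x)`, with `G_x` identified with `G^x` by inversion. -/
noncomputable def toSourceLp (x : X) : C_c(G, ℂ) →ₗ[ℂ] Lp ℂ 2 (μ.measure x) where
  toFun g := (memLp_inv_fiber μ g x).toLp _
  map_add' _ _ := rfl
  map_smul' _ _ := rfl

theorem enorm_toSourceLp (x : X) (g : C_c(G, ℂ)) : ‖toSourceLp μ x g‖ₑ = sourceL2Norm μ x g :=
  Lp.enorm_toLp (memLp_inv_fiber μ g x)

theorem coeFn_toSourceLp (x : X) (g : C_c(G, ℂ)) :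
    toSourceLp μ x g =ᵐ[μ.measure x] fun η => g (𝒢.inv η.1) :=
  MemLp.coeFn_toLp (memLp_inv_fiber μ g x)

theorem integrable_conv_kernel (f g : C_c(G, ℂ)) {x : X} (ζ : 𝒢.Fiber x) :
    Integrable (fun η : 𝒢.Fiber x => f (𝒢.fiberLdiv ζ η) * g (𝒢.inv η.1)) (μ.measure x) :=
  ((f.continuous.comp ((TopGroupoid.continuous_fiberLdiv x).comp
    (Continuous.prodMk_right ζ))).mul (g.continuous.comp
      (TopGroupoid.continuous_inv_fiber x))).integrable_of_hasCompactSupport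
    (TopGroupoid.hasCompactSupport_inv_fiber g x).mul_left

/-- Left convolution operators, restricted to one source fibre. -/
noncomputable def convSourceLp (x : X) (g : C_c(G, ℂ)) : C_c(G, ℂ) →ₗ[ℂ] Lp ℂ 2 (μ.measure x) where
  toFun f := toSourceLp μ x (convCc μ f g)
  map_add' f f' := by
    rw [← map_add]
    refine Lp.ext ?_
    filter_upwards [coeFn_toSourceLp μ x (convCc μ (f + f') g),
      coeFn_toSourceLp μ x (convCc μ f g + convCc μ f' g)] with ζ h1 h2
    rw [h1, h2]
    simp only [CompactlySupportedContinuousMap.add_apply, convCc_apply, conv_inv_fiber]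
    rw [← integral_add (integrable_conv_kernel μ f g ζ) (integrable_conv_kernel μ f' g ζ)]
    simp [add_mul]
  map_smul' k f := by
    rw [RingHom.id_apply, ← map_smul]
    refine Lp.ext ?_
    filter_upwards [coeFn_toSourceLp μ x (convCc μ (k • f) g),
      coeFn_toSourceLp μ x (k • convCc μ f g)] with ζ h1 h2
    rw [h1, h2]
    simp only [CompactlySupportedContinuousMap.smul_apply, convCc_apply, conv_inv_fiber]
    rw [← integral_smul]
    simp [mul_assoc]

end Regular

/-! ## Sections as operators on the fibres -/

section FiberOperators

variable {X : Type u} {G : Type v} [TopologicalSpace X] [TopologicalSpace G]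
  [T2Space G] [LocallyCompactSpace G] [SecondCountableTopology G]
  [MeasurableSpace G] [BorelSpace G] {𝒢 : TopGroupoid X G} (μ : HaarSystem 𝒢)
  {E : X → Type w} [∀ x, NormedAddCommGroup (E x)] [∀ x, InnerProductSpace ℂ (E x)]
  [TopologicalSpace (TotalSpace ℂ E)] [IsHilbertBundle E] (L : GroupoidAction 𝒢 E)

/-- The kernel `(ζ, η) ↦ L(ζ) ξ(ζ⁻¹ η)` on `G^x × G^x` with values in `E_x`. -/
def fiberKernel (ξ : CcSections 𝒢 E) {x : X} (ζ η : 𝒢.Fiber x) : E x :=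
  L.act ζ.1 rfl ζ.2 (secAt ξ.1 (𝒢.fiberLdiv ζ η) (TopGroupoid.r_fiberLdiv ζ η))

theorem fiberKernel_add (ξ ξ' : CcSections 𝒢 E) {x : X} (ζ η : 𝒢.Fiber x) :
    fiberKernel L (ξ + ξ') ζ η = fiberKernel L ξ ζ η + fiberKernel L ξ' ζ η := by
  unfold fiberKernel
  rw [Submodule.coe_add, secAt_add, map_add]

theorem fiberKernel_smul (k : ℂ) (ξ : CcSections 𝒢 E) {x : X} (ζ η : 𝒢.Fiber x) :
    fiberKernel L (k • ξ) ζ η = k • fiberKernel L ξ ζ η := by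
  unfold fiberKernel
  rw [Submodule.coe_smul, secAt_const_smul, map_smul]

theorem continuousAlong_fiberKernel (ξ : CcSections 𝒢 E) (x : X) {Z : Type*} [TopologicalSpace Z]
    {a b : Z → G} (ha : Continuous a) (hb : Continuous b) (ha' : ∀ z, 𝒢.r (a z) = x)
    (hb' : ∀ z, 𝒢.r (b z) = x) :
    ContinuousAlong (fun _ => x) fun z => fiberKernel L ξ ⟨a z, ha' z⟩ ⟨b z, hb' z⟩ :=
  L.continuousAlong_act ha (fun _ => rfl) ha'
    (ξ.2.1.secAt_along (𝒢.continuous_ldiv_comp ha hb fun z => (ha' z).trans (hb' z).symm) _)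

theorem continuous_fiberKernel (ξ : CcSections 𝒢 E) (x : X) :
    Continuous (Function.uncurry fun ζ η : 𝒢.Fiber x => fiberKernel L ξ ζ η) :=
  ContinuousAlong.continuous_of_const (continuousAlong_fiberKernel L ξ x
    (continuous_subtype_val.comp continuous_fst) (continuous_subtype_val.comp continuous_snd)
    (fun z => z.1.2) (fun z => z.2.2))

/-- The operator with kernel `fiberKernel L ξ`, applied to the restriction of `g`. Up to the
isometries `L(ζ)` it is the right convolution product `ξ g` on `G_x`. -/
noncomputable def fiberOp (ξ : CcSections 𝒢 E) (g : G → ℂ) {x : X} (ζ : 𝒢.Fiber x) : E x :=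
  ∫ η : 𝒢.Fiber x, g (𝒢.inv η.1) • fiberKernel L ξ ζ η ∂(μ.measure x)

theorem continuous_fiberOp (ξ : CcSections 𝒢 E) (g : C_c(G, ℂ)) (x : X) :
    Continuous fun ζ : 𝒢.Fiber x => fiberOp μ L ξ g ζ := by
  refine ContinuousAlong.continuous_of_const
    (μ.continuousAlong_integral_fiber (p := fun _ : 𝒢.Fiber x => x)
      (F := fun ζ η h => g (𝒢.inv η) • fiberKernel L ξ ζ ⟨η, h⟩) continuous_const ?_
      (g.hasCompactSupport.isCompact.image 𝒢.continuous_inv) fun ζ η h hη => ?_)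
  · have h2 : Continuous fun q : {q : 𝒢.Fiber x × G // 𝒢.r q.2 = x} => q.1.2 :=
      continuous_snd.comp continuous_subtype_val
    exact (continuousAlong_fiberKernel L ξ x (continuous_subtype_val.comp
      (continuous_fst.comp continuous_subtype_val)) h2 (fun q => q.1.1.2) (fun q => q.2)).smul
      (g.continuous.comp (𝒢.continuous_inv.comp h2))
  · rw [image_eq_zero_of_notMem_tsupport (f := g) fun h' => hη ⟨_, h', 𝒢.inv_inv _⟩, zero_smul]

/-- If the product is nonzero, then `τ = η (η⁻¹τ)` with `η ∈ (supp g)⁻¹` and `η⁻¹τ ∈ K⁻¹`, where `ξ`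
vanishes off `K`. -/
theorem exists_isCompact_fiberKernel_eq_zero (ξ : CcSections 𝒢 E) (g : C_c(G, ℂ)) (x : X) :
    ∃ S : Set (𝒢.Fiber x), IsCompact S ∧
      ∀ τ η, τ ∉ S → g (𝒢.inv η.1) • fiberKernel L ξ τ η = 0 := by
  obtain ⟨K, hK, hξK⟩ := ξ.2.2
  refine ⟨_, 𝒢.isCompact_fiber_preimage x (𝒢.isCompact_mulSet
    (g.hasCompactSupport.isCompact.image 𝒢.continuous_inv) (hK.image 𝒢.continuous_inv)),
    fun τ η hτ => ?_⟩
  by_contra hne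
  refine hτ (𝒢.mem_mulSet_of_ldiv (a := η.1) ?_ (η.2.trans τ.2.symm) ?_)
  · by_contra h
    exact hne (by rw [image_eq_zero_of_notMem_tsupport (f := g) fun h' => h ⟨_, h', 𝒢.inv_inv _⟩,
      zero_smul])
  · by_contra h
    refine hne ?_
    unfold fiberKernel
    rw [secAt_eq_zero _ (hξK _ fun h' => h ⟨_, h', TopGroupoid.inv_fiberLdiv τ η⟩), map_zero,
      smul_zero]

theorem integrable_fiberOp_kernel (ξ : CcSections 𝒢 E) (g : C_c(G, ℂ)) {x : X} (ζ : 𝒢.Fiber x) :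
    Integrable (fun η : 𝒢.Fiber x => g (𝒢.inv η.1) • fiberKernel L ξ ζ η) (μ.measure x) :=
  ((g.continuous.comp (TopGroupoid.continuous_inv_fiber x)).smul
    ((continuous_fiberKernel L ξ x).comp
      (Continuous.prodMk_right ζ))).integrable_of_hasCompactSupport
    (TopGroupoid.hasCompactSupport_inv_fiber g x).smul_right

theorem memLp_fiberOp (ξ : CcSections 𝒢 E) (g : C_c(G, ℂ)) (x : X) :
    MemLp (fun ζ : 𝒢.Fiber x => fiberOp μ L ξ g ζ) 2 (μ.measure x) := by
  obtain ⟨S, hS, hS0⟩ := exists_isCompact_fiberKernel_eq_zero L ξ g x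
  exact (continuous_fiberOp μ L ξ g x).memLp_of_hasCompactSupport
    (HasCompactSupport.intro hS fun τ hτ => by simp [fiberOp, hS0 τ _ hτ])

/-- `ξ ↦ ξ g` as a linear map into the `L²`-sections over one source fibre. -/
noncomputable def fiberOpLp (x : X) (g : C_c(G, ℂ)) :
    CcSections 𝒢 E →ₗ[ℂ] Lp (E x) 2 (μ.measure x) where
  toFun ξ := (memLp_fiberOp μ L ξ g x).toLp _
  map_add' ξ ξ' := by
    rw [← MemLp.toLp_add, MemLp.toLp_eq_toLp_iff]
    refine Eventually.of_forall fun ζ => ?_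
    simp only [fiberOp, fiberKernel_add, smul_add, Pi.add_apply]
    exact integral_add (integrable_fiberOp_kernel μ L ξ g ζ) (integrable_fiberOp_kernel μ L ξ' g ζ)
  map_smul' k ξ := by
    rw [RingHom.id_apply, ← MemLp.toLp_const_smul, MemLp.toLp_eq_toLp_iff]
    refine Eventually.of_forall fun ζ => ?_
    simp only [fiberOp, fiberKernel_smul, Pi.smul_apply]
    rw [← integral_smul]
    simp only [smul_comm k]

theorem coeFn_fiberOpLp (x : X) (g : C_c(G, ℂ)) (ξ : CcSections 𝒢 E) :
    fiberOpLp μ L x g ξ =ᵐ[μ.measure x] fun ζ => fiberOp μ L ξ g ζ :=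
  MemLp.coeFn_toLp (memLp_fiberOp μ L ξ g x)

theorem fiberOpLp_smul (x : X) (k : ℂ) (g : C_c(G, ℂ)) (ξ : CcSections 𝒢 E) :
    fiberOpLp μ L x (k • g) ξ = k • fiberOpLp μ L x g ξ := by
  refine Lp.ext ?_
  filter_upwards [coeFn_fiberOpLp μ L x (k • g) ξ, coeFn_fiberOpLp μ L x g ξ,
    Lp.coeFn_smul k (fiberOpLp μ L x g ξ)] with ζ h1 h2 h3
  rw [h1, h3, Pi.smul_apply, h2]
  simp only [fiberOp, CompactlySupportedContinuousMap.smul_apply, smul_eq_mul]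
  rw [← integral_smul]
  simp only [smul_smul]

theorem GroupoidAction.inner_act_secAt (ξ ξ' : ∀ γ : G, E (𝒢.r γ)) {x y : X} {γ a b : G}
    (hs : 𝒢.s γ = y) (hr : 𝒢.r γ = x) (ha : 𝒢.r a = y) (hb : 𝒢.r b = y) :
    inner ℂ (L.act γ rfl hr (secAt ξ a (ha.trans hs.symm)))
      (L.act γ rfl hr (secAt ξ' b (hb.trans hs.symm))) =
      inner ℂ (secAt ξ a ha) (secAt ξ' b hb) := by
  subst hs
  exact LinearIsometry.inner_map_map _ _ _

/-- Translate by `ζ`: `(ζτ)⁻¹ζ = τ⁻¹` and `(ζτ)⁻¹η = τ⁻¹(ζ⁻¹η)`, while `L(ζτ)` is isometric and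
drops out of the inner product. So `⟨ξ, ξ'⟩(ζ⁻¹η)` is the kernel of `T_ξ^* T_{ξ'}`. -/
theorem innerProd_fiberLdiv (ξ ξ' : CcSections 𝒢 E) {x : X} (ζ η : 𝒢.Fiber x) :
    innerProd μ ξ.1 ξ'.1 (𝒢.fiberLdiv ζ η) =
      ∫ τ : 𝒢.Fiber x, inner ℂ (fiberKernel L ξ τ ζ) (fiberKernel L ξ' τ η) ∂(μ.measure x) := by
  refine (μ.integral_congr_base (TopGroupoid.r_fiberLdiv ζ η) (fun τ h => inner ℂ
    (secAt ξ.1 (𝒢.inv τ) (𝒢.r_inv τ))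
    (secAt ξ'.1 (𝒢.ldiv τ (𝒢.fiberLdiv ζ η) h) (𝒢.r_ldiv _ _ _)))).trans ?_
  rw [μ.integral_translate ζ.1 rfl ζ.2 (fun τ h => inner ℂ (fiberKernel L ξ ⟨τ, h⟩ ζ)
    (fiberKernel L ξ' ⟨τ, h⟩ η))]
  refine integral_congr_ae (Eventually.of_forall fun τ => ?_)
  have hs : 𝒢.s (𝒢.mul ζ.1 τ.1 τ.2.symm) = 𝒢.s τ.1 := 𝒢.s_mul _ _ _
  refine Eq.symm ((L.inner_act_secAt ξ.1 ξ'.1 hs ((𝒢.r_mul _ _ _).trans ζ.2)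
    ((𝒢.r_ldiv _ _ _).trans hs) ((𝒢.r_ldiv _ _ _).trans hs)).trans ?_)
  congr 1
  · exact secAt_congr _ (𝒢.ldiv_mul_self_right _ _ _) _
  · exact secAt_congr _ (𝒢.ldiv_mul ζ.1 τ.1 η.1 τ.2.symm (ζ.2.trans η.2.symm)) _

theorem inner_toSourceLp_convCc_innerProdCc (x : X) (ξ : CcSections 𝒢 E) (h g : C_c(G, ℂ)) :
    inner ℂ (toSourceLp μ x h) (toSourceLp μ x (convCc μ (innerProdCc μ ξ ξ) g)) =
      inner ℂ (fiberOpLp μ L x h ξ) (fiberOpLp μ L x g ξ) := by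
  have hcompl : CompleteSpace (E x) := IsHilbertBundle.complete x
  obtain ⟨S, hS, hS0⟩ := exists_isCompact_fiberKernel_eq_zero L ξ g x
  have key := integral_inner_kernel (m := μ.measure x) (continuous_fiberKernel L ξ x)
    (h.continuous.comp (TopGroupoid.continuous_inv_fiber x))
    (g.continuous.comp (TopGroupoid.continuous_inv_fiber x))
    (TopGroupoid.hasCompactSupport_inv_fiber h x) (TopGroupoid.hasCompactSupport_inv_fiber g x)
    hS hS0 (continuous_fiberOp μ L ξ g x)
  rw [L2.inner_def, L2.inner_def]
  refine Eq.trans (integral_congr_ae ?_) (key.trans (integral_congr_ae ?_))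
  · filter_upwards [coeFn_toSourceLp μ x h,
      coeFn_toSourceLp μ x (convCc μ (innerProdCc μ ξ ξ) g)] with ζ h1 h2
    rw [h1, h2, convCc_apply, conv_inv_fiber, RCLike.inner_apply, mul_comm]
    simp only [innerProdCc_apply, innerProd_fiberLdiv μ L, Function.comp_apply]
    rfl
  · filter_upwards [coeFn_fiberOpLp μ L x h ξ, coeFn_fiberOpLp μ L x g ξ] with ζ h1 h2
    rw [h1, h2]
    rfl

/-! ## The reduced norm of a section -/

theorem moduleNorm_reducedNorm_lt_top (ξ : CcSections 𝒢 E) :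
    moduleNorm μ (reducedNorm μ) ξ.1 < ∞ :=
  ENNReal.rpow_lt_top_of_nonneg (by norm_num) (reducedNorm_lt_top μ (innerProdCc μ ξ ξ)).ne

theorem enorm_convSourceLp_le (x : X) (f g : C_c(G, ℂ)) (hg : sourceL2Norm μ x g ≤ 1) :
    ‖toSourceLp μ x (convCc μ f g)‖ₑ ≤ reducedNorm μ f := by
  rw [enorm_toSourceLp]
  exact le_iSup_of_le x (le_iSup₂_of_le g hg le_rfl)

/-- Since `‖T_ξ g‖² = ⟨g, ⟨ξ, ξ⟩ * g⟩`, Cauchy–Schwarz bounds it by the reduced norm of `⟨ξ, ξ⟩`. -/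
theorem enorm_fiberOpLp_le (x : X) (g : C_c(G, ℂ)) (hg : sourceL2Norm μ x g ≤ 1)
    (ξ : CcSections 𝒢 E) : ‖fiberOpLp μ L x g ξ‖ₑ ≤ moduleNorm μ (reducedNorm μ) ξ.1 := by
  have h1 := inner_toSourceLp_convCc_innerProdCc μ L x ξ g g
  have h2 : ‖fiberOpLp μ L x g ξ‖ ^ 2 ≤ ‖toSourceLp μ x g‖ *
      ‖toSourceLp μ x (convCc μ (innerProdCc μ ξ ξ) g)‖ := by
    rw [norm_sq_eq_re_inner (𝕜 := ℂ), ← h1]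
    exact (RCLike.re_le_norm _).trans (norm_inner_le_norm _ _)
  have h3 : ‖fiberOpLp μ L x g ξ‖ₑ ^ (2 : ℝ) ≤ ‖toSourceLp μ x g‖ₑ *
      ‖toSourceLp μ x (convCc μ (innerProdCc μ ξ ξ) g)‖ₑ := by
    simp only [← ofReal_norm]
    rw [← ENNReal.ofReal_mul (norm_nonneg _),
      ENNReal.ofReal_rpow_of_nonneg (norm_nonneg _) zero_le_two]
    exact ENNReal.ofReal_le_ofReal (by simpa using h2)
  unfold moduleNorm
  rw [one_div, ENNReal.le_rpow_inv_iff zero_lt_two]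
  refine h3.trans ?_
  rw [← one_mul (reducedNorm μ _)]
  gcongr
  · rwa [enorm_toSourceLp]
  · exact enorm_convSourceLp_le μ x (innerProdCc μ ξ ξ) g hg

/-- The function `k = ⟨ξ, ξ⟩ * g` lies in `C_c(G)`, so it can itself be a test function: `‖k‖² =
⟨T_ξ k, T_ξ g⟩ ≤ (‖k‖ C) C`, whence `‖k‖ ≤ C²`. -/
theorem moduleNorm_reducedNorm_le (ξ : CcSections 𝒢 E) {C : ℝ} (hC0 : 0 ≤ C)
    (hC : ∀ x (g : C_c(G, ℂ)), sourceL2Norm μ x g ≤ 1 → ‖fiberOpLp μ L x g ξ‖ ≤ C) :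
    moduleNorm μ (reducedNorm μ) ξ.1 ≤ ENNReal.ofReal C := by
  unfold moduleNorm
  rw [one_div, ENNReal.rpow_inv_le_iff zero_lt_two,
    ENNReal.ofReal_rpow_of_nonneg hC0 zero_le_two]
  refine iSup_le fun x => iSup_le fun g => iSup_le fun hg => ?_
  set k : C_c(G, ℂ) := convCc μ (innerProdCc μ ξ ξ) g with hk
  change sourceL2Norm μ x k ≤ _
  rw [← enorm_toSourceLp, ← ofReal_norm]
  refine ENNReal.ofReal_le_ofReal ?_
  rw [Real.rpow_two]
  set n : ℝ := ‖toSourceLp μ x k‖ with hn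
  rcases (norm_nonneg (toSourceLp μ x k)).eq_or_lt with h0 | h0
  · rw [hn, ← h0]; positivity
  have hnc : (n : ℂ) ≠ 0 := by exact_mod_cast h0.ne'
  have h1 := hC x ((n : ℂ)⁻¹ • k) (by
    rw [← enorm_toSourceLp, ← ofReal_norm, map_smul, norm_smul, norm_inv, Complex.norm_real, hn,
      norm_norm, inv_mul_cancel₀ h0.ne', ENNReal.ofReal_one])
  have h2 : ‖fiberOpLp μ L x k ξ‖ ≤ n * C := by
    rw [fiberOpLp_smul, norm_smul, norm_inv, Complex.norm_real, hn, norm_norm] at h1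
    rwa [inv_mul_le_iff₀ h0] at h1
  have h3 : n ^ 2 ≤ (n * C) * C := by
    rw [hn, norm_sq_eq_re_inner (𝕜 := ℂ), ← hn]
    nth_rewrite 2 [hk]
    rw [inner_toSourceLp_convCc_innerProdCc μ L]
    refine (RCLike.re_le_norm _).trans ((norm_inner_le_norm _ _).trans ?_)
    exact mul_le_mul h2 (hC x g hg) (norm_nonneg _) (by positivity)
  have : n * n ≤ n * C ^ 2 := by linarith [h3]
  exact le_of_mul_le_mul_left this h0

end FiberOperators

/-! ## Completions and closability -/

section Seminorms

variable {V : Type*} [AddCommGroup V] [Module ℂ V] {N : V → ℝ≥0∞}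

/-- The supremum defining `toSeminorm` is meaningful only for a family bounded above; finiteness of
`N` supplies the bound. -/
theorem bddAbove_seminorm_le (hN : ∀ v, N v < ∞) :
    BddAbove {p : Seminorm ℂ V | ∀ v, ENNReal.ofReal (p v) ≤ N v} := by
  rw [Seminorm.bddAbove_iff]
  refine ⟨fun v => (N v).toReal, ?_⟩
  rintro _ ⟨p, hp, rfl⟩ v
  exact (ENNReal.ofReal_le_iff_le_toReal (hN v).ne).1 (hp v)

theorem le_toSeminorm (hN : ∀ v, N v < ∞) (p : Seminorm ℂ V)
    (hp : ∀ v, ENNReal.ofReal (p v) ≤ N v) : p ≤ toSeminorm N :=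
  le_csSup (bddAbove_seminorm_le hN) hp

theorem toSeminorm_le (hN : ∀ v, N v < ∞) (v : V) : ENNReal.ofReal (toSeminorm N v) ≤ N v := by
  rw [ENNReal.ofReal_le_iff_le_toReal (hN v).ne]
  have hne : {p : Seminorm ℂ V | ∀ v, ENNReal.ofReal (p v) ≤ N v}.Nonempty :=
    ⟨0, fun v => by simp⟩
  have : Nonempty {p : Seminorm ℂ V | ∀ v, ENNReal.ofReal (p v) ≤ N v} := hne.to_subtype
  unfold toSeminorm
  rw [Seminorm.sSup_apply (bddAbove_seminorm_le hN)]
  exact ciSup_le fun p => (ENNReal.ofReal_le_iff_le_toReal (hN v).ne).1 (p.2 v)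

/-- The function `‖A ·‖` is one of the seminorms whose supremum is `toSeminorm N`. With
`toSeminorm_le`, this avoids having to know that `N` is itself a seminorm. -/
theorem norm_le_toSeminorm (hN : ∀ v, N v < ∞) {H : Type*} [NormedAddCommGroup H]
    [NormedSpace ℂ H] (A : V →ₗ[ℂ] H) (hA : ∀ v, ‖A v‖ₑ ≤ N v) (v : V) :
    ‖A v‖ ≤ toSeminorm N v :=
  le_toSeminorm hN ((normSeminorm ℂ H).comp A) (fun v => by
    simpa [ofReal_norm] using hA v) v

theorem norm_toCompletion (v : V) : ‖toCompletion N v‖ = toSeminorm N v :=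
  LinearIsometry.norm_map (UniformSpace.Completion.toComplₗᵢ (𝕜 := ℂ)
    (E := WithSeminorm (toSeminorm N))) v

/-- A criterion for closability of `δ : V → W` between completions: the norm `M` on `W` is the
supremum of the seminorms `‖A i ·‖`, and each `A i ∘ δ` is closable. -/
theorem eq_zero_of_mem_closure_range {W : Type*} [AddCommGroup W] [Module ℂ W] {M : W → ℝ≥0∞}
    (δ : V →ₗ[ℂ] W) {ι : Type*} {H : ι → Type*} [∀ i, NormedAddCommGroup (H i)]
    [∀ i, NormedSpace ℂ (H i)] [∀ i, CompleteSpace (H i)] (A : ∀ i, W →ₗ[ℂ] H i)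
    (hM : ∀ w, M w < ∞) (hA : ∀ i w, ‖A i w‖ₑ ≤ M w)
    (hsup : ∀ (w : W) (C : ℝ), 0 ≤ C → (∀ i, ‖A i w‖ ≤ C) → M w ≤ ENNReal.ofReal C)
    (hcl : ∀ i (v : ℕ → V) (y : H i), Tendsto (fun n => toSeminorm N (v n)) atTop (𝓝 0) →
      Tendsto (fun n => A i (δ (v n))) atTop (𝓝 y) → y = 0)
    {z : NormCompletion N × NormCompletion M}
    (hz : z ∈ (LinearMap.range ((toCompletion N).prod
      ((toCompletion M).comp δ))).topologicalClosure) (hz0 : z.1 = 0) : z.2 = 0 := by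
  rw [← SetLike.mem_coe, Submodule.topologicalClosure_coe, mem_closure_iff_seq_limit] at hz
  obtain ⟨t, ht, htz⟩ := hz
  choose v hv using ht
  have h1 : Tendsto (fun n => toSeminorm N (v n)) atTop (𝓝 0) := by
    have := (((continuous_fst.tendsto z).comp htz)).norm
    rw [hz0, norm_zero] at this
    refine this.congr fun n => ?_
    simp only [Function.comp_apply, ← hv n]
    exact norm_toCompletion (v n)
  have h2 : Tendsto (fun n => toCompletion M (δ (v n))) atTop (𝓝 z.2) := by
    refine ((continuous_snd.tendsto z).comp htz).congr fun n => ?_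
    simp only [Function.comp_apply, ← hv n]
    rfl
  have hcau := Metric.cauchySeq_iff.1 h2.cauchySeq
  simp only [dist_eq_norm, ← map_sub, norm_toCompletion] at hcau
  have hle (i : ι) (w : W) : ‖A i w‖ ≤ toSeminorm M w := norm_le_toSeminorm hM (A i) (hA i) w
  -- Each `A i` is contractive for the norm of the completion, so the sequence is Cauchy in `H i`;
  -- closability of `A i ∘ δ` forces its limit to be `0`.
  have hlim (i : ι) : Tendsto (fun n => A i (δ (v n))) atTop (𝓝 0) := by
    have hc : CauchySeq fun n => A i (δ (v n)) := by
      refine Metric.cauchySeq_iff.2 fun ε hε => ?_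
      obtain ⟨n₀, hn₀⟩ := hcau ε hε
      refine ⟨n₀, fun m hm n hn => ?_⟩
      rw [dist_eq_norm, ← map_sub, ← map_sub]
      exact (hle i _).trans_lt (hn₀ m hm n hn)
    obtain ⟨y, hy⟩ := cauchySeq_tendsto_of_complete hc
    rwa [hcl i v y h1 hy] at hy
  refine tendsto_nhds_unique h2 (squeeze_zero_norm' (a := fun n => toSeminorm M (δ (v n)))
    (Eventually.of_forall fun n => (norm_toCompletion _).le) ?_)
  rw [Metric.tendsto_atTop]
  intro ε hε
  obtain ⟨n₀, hn₀⟩ := hcau (ε / 2) (half_pos hε)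
  refine ⟨n₀, fun n hn => ?_⟩
  -- Letting `m → ∞` in the Cauchy estimate, with `n₀` independent of `i`, gives a bound uniform in
  -- `i`, which `hsup` turns into a bound for `M`.
  have hb (i : ι) : ‖A i (δ (v n))‖ ≤ ε / 2 := by
    have h3 : Tendsto (fun m => ‖A i (δ (v n)) - A i (δ (v m))‖) atTop
        (𝓝 ‖A i (δ (v n)) - 0‖) := (tendsto_const_nhds.sub (hlim i)).norm
    rw [sub_zero] at h3
    refine le_of_tendsto h3 (eventually_atTop.2 ⟨n₀, fun m hm => ?_⟩)
    rw [← map_sub, ← map_sub]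
    exact (hle i _).trans (hn₀ n hn m hm).le
  have h4 := (toSeminorm_le hM (δ (v n))).trans (hsup _ _ (half_pos hε).le hb)
  rw [ENNReal.ofReal_le_ofReal_iff (half_pos hε).le] at h4
  rw [Real.dist_0_eq_abs, abs_of_nonneg (apply_nonneg _ _)]
  exact h4.trans_lt (half_lt_self hε)

end Seminorms

/-! ### Closability of the cocycle derivation on each source fibre -/

section Closability

variable {X : Type u} {G : Type v} [TopologicalSpace X] [TopologicalSpace G]
  [T2Space G] [LocallyCompactSpace G] [SecondCountableTopology G]
  [MeasurableSpace G] [BorelSpace G] {𝒢 : TopGroupoid X G} (μ : HaarSystem 𝒢)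
  {E : X → Type w} [∀ x, NormedAddCommGroup (E x)] [∀ x, InnerProductSpace ℂ (E x)]
  [TopologicalSpace (TotalSpace ℂ E)] [IsHilbertBundle E] {L : GroupoidAction 𝒢 E}

theorem convCc_smul_right (k : ℂ) (f g : C_c(G, ℂ)) :
    convCc μ f (k • g) = k • convCc μ f g := by
  ext γ
  simp only [convCc_apply, conv, CompactlySupportedContinuousMap.smul_apply, smul_eq_mul]
  rw [← integral_const_mul]
  simp only [mul_left_comm]

theorem tendsto_convSourceLp {f : ℕ → C_c(G, ℂ)}
    (hf : Tendsto (fun n => toSeminorm (fun f : C_c(G, ℂ) => reducedNorm μ f) (f n)) atTop (𝓝 0))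
    (x : X) (g : C_c(G, ℂ)) : Tendsto (fun n => convSourceLp μ x g (f n)) atTop (𝓝 0) := by
  -- Scaling by `1 + ‖g‖` instead of `‖g‖` brings `g` into the unit ball and also covers `g = 0` on
  -- the fibre.
  set k : ℝ := 1 + ‖toSourceLp μ x g‖ with hk
  have hk0 : 0 < k := by positivity
  have hkc : (k : ℂ) ≠ 0 := by exact_mod_cast hk0.ne'
  have hg : sourceL2Norm μ x ((k : ℂ)⁻¹ • g) ≤ 1 := by
    have h1 := enorm_toSourceLp μ x ((k : ℂ)⁻¹ • g)
    rw [map_smul, ← ofReal_norm, norm_smul, norm_inv, Complex.norm_real,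
      Real.norm_of_nonneg hk0.le] at h1
    refine h1.symm.le.trans (ENNReal.ofReal_le_one.2 ?_)
    rw [inv_mul_le_iff₀ hk0, mul_one, hk]
    linarith
  have hb (n : ℕ) : ‖convSourceLp μ x ((k : ℂ)⁻¹ • g) (f n)‖ ≤
      toSeminorm (fun f : C_c(G, ℂ) => reducedNorm μ f) (f n) :=
    norm_le_toSeminorm (reducedNorm_lt_top μ) _
      (fun f => enorm_convSourceLp_le μ x f ((k : ℂ)⁻¹ • g) hg) (f n)
  have h2 := (squeeze_zero_norm hb hf).const_smul (k : ℂ)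
  rw [smul_zero] at h2
  refine h2.congr fun n => ?_
  change (k : ℂ) • toSourceLp μ x (convCc μ (f n) ((k : ℂ)⁻¹ • g)) = toSourceLp μ x _
  rw [convCc_smul_right, map_smul, smul_inv_smul₀ hkc]

/-- Since `η = ζ (ζ⁻¹η)`, the cocycle identity reads `L(ζ) c(ζ⁻¹η) = c(η) - c(ζ)`. This exhibits
`T_{∂f}` as a commutator with multiplication by `c`. -/
theorem fiberKernel_cocycleDerivation {c : ∀ γ : G, E (𝒢.r γ)} (hc : IsContinuousCocycle L c)
    (f : C_c(G, ℂ)) {x : X} (ζ η : 𝒢.Fiber x) :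
    fiberKernel L (cocycleDerivation c hc.continuous f) ζ η =
      (Complex.I * f (𝒢.fiberLdiv ζ η)) • (secAt c η.1 η.2 - secAt c ζ.1 ζ.2) := by
  have h := hc.secAt_mul ζ.1 (𝒢.fiberLdiv ζ η) (TopGroupoid.r_fiberLdiv ζ η).symm ζ.2
    (TopGroupoid.r_fiberLdiv ζ η)
  have e : 𝒢.mul ζ.1 (𝒢.fiberLdiv ζ η) (TopGroupoid.r_fiberLdiv ζ η).symm = η.1 := 𝒢.mul_ldiv _ _ _
  rw [secAt_congr c e] at h
  rw [h, add_sub_cancel_left]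
  unfold fiberKernel
  rw [secAt_cocycleDerivation, map_smul]

theorem continuous_secAt_fiber {c : ∀ γ : G, E (𝒢.r γ)} (hc : ContinuousSection c) (x : X) :
    Continuous fun η : 𝒢.Fiber x => secAt c η.1 η.2 :=
  ContinuousAlong.continuous_of_const (hc.secAt_along continuous_subtype_val fun η => η.2)

/-- Here `g'(η⁻¹) = g(η⁻¹) (e | c(η))` on `G^x`; only these values matter, so any extension to
`C_c(G)` will do. What counts is that `g'` does not depend on `f`. -/
theorem exists_inner_fiberOp_cocycleDerivation {c : ∀ γ : G, E (𝒢.r γ)}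
    (hc : IsContinuousCocycle L c) (g : C_c(G, ℂ)) {x : X} (e : E x) :
    ∃ g' : C_c(G, ℂ), ∀ (f : C_c(G, ℂ)) (ζ : 𝒢.Fiber x),
      inner ℂ e (fiberOp μ L (cocycleDerivation c hc.continuous f) g ζ) =
        Complex.I * conv μ f g' (𝒢.inv ζ.1) -
          Complex.I * inner ℂ e (secAt c ζ.1 ζ.2) * conv μ f g (𝒢.inv ζ.1) := by
  have hcompl : CompleteSpace (E x) := IsHilbertBundle.complete x
  obtain ⟨φ, hφ⟩ := exists_compactlySupported_extension (𝒢.isClosed_fiber x)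
    (f := fun η => g (𝒢.inv η.1) * inner ℂ e (secAt c η.1 η.2))
    ((g.continuous.comp (TopGroupoid.continuous_inv_fiber x)).mul
      (continuous_const.inner (continuous_secAt_fiber hc.continuous x)))
    (g.hasCompactSupport.isCompact.image 𝒢.continuous_inv)
    (fun η hη => by
      rw [image_eq_zero_of_notMem_tsupport (f := g) fun h' => hη ⟨_, h', 𝒢.inv_inv _⟩, zero_mul])
  refine ⟨invCc 𝒢 φ, fun f ζ => ?_⟩
  rw [conv_inv_fiber, conv_inv_fiber, ← integral_const_mul, ← integral_const_mul,
    ← integral_sub ((integrable_conv_kernel μ f (invCc 𝒢 φ) ζ).const_mul _)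
      ((integrable_conv_kernel μ f g ζ).const_mul _), fiberOp,
    ← integral_inner (integrable_fiberOp_kernel μ L _ g ζ)]
  refine integral_congr_ae (Eventually.of_forall fun η => ?_)
  have h1 : φ η.1 = g (𝒢.inv η.1) * inner ℂ e (secAt c η.1 η.2) := hφ η
  simp only [fiberKernel_cocycleDerivation hc, inner_smul_right, inner_sub_right, invCc_apply,
    𝒢.inv_inv, h1]
  ring

theorem exists_subseq_tendsto_ae {Y : Type*} [MeasurableSpace Y] {m : Measure Y} {H : Type*}
    [NormedAddCommGroup H] {F : ℕ → Lp H 2 m} {y : Lp H 2 m} (h : Tendsto F atTop (𝓝 y)) :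
    ∃ ns : ℕ → ℕ, Tendsto ns atTop atTop ∧
      ∀ᵐ t ∂m, Tendsto (fun n => F (ns n) t) atTop (𝓝 (y t)) := by
  obtain ⟨ns, h1, h2⟩ := (tendstoInMeasure_of_tendsto_Lp h).exists_seq_tendsto_ae
  exact ⟨ns, h1.tendsto_atTop, h2⟩

/-- Multiplication by `c` may be unbounded on `L²`, but at a fixed `ζ` the coefficient `(e | c(ζ))`
is a constant, so almost everywhere convergence suffices to pass to the limit. -/
theorem eq_zero_of_tendsto_fiberOpLp {c : ∀ γ : G, E (𝒢.r γ)} (hc : IsContinuousCocycle L c)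
    (x : X) (g : C_c(G, ℂ)) {f : ℕ → C_c(G, ℂ)} {y : Lp (E x) 2 (μ.measure x)}
    (hf : Tendsto (fun n => toSeminorm (fun f : C_c(G, ℂ) => reducedNorm μ f) (f n)) atTop (𝓝 0))
    (hy : Tendsto (fun n => fiberOpLp μ L x g (cocycleDerivation c hc.continuous (f n))) atTop
      (𝓝 y)) : y = 0 := by
  have hcompl : CompleteSpace (E x) := IsHilbertBundle.complete x
  have key (e : E x) : (fun ζ => inner ℂ e (y ζ)) =ᵐ[μ.measure x] 0 := by
    obtain ⟨g', hg'⟩ := exists_inner_fiberOp_cocycleDerivation μ hc g e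
    -- Three nested subsequences make the images of `∂f_n`, the `f_n * g` and the `f_n * g'`
    -- converge a.e. simultaneously.
    obtain ⟨n₁, hn₁, ha₁⟩ := exists_subseq_tendsto_ae hy
    obtain ⟨n₂, hn₂, ha₂⟩ := exists_subseq_tendsto_ae
      ((tendsto_convSourceLp μ hf x g).comp hn₁)
    obtain ⟨n₃, hn₃, ha₃⟩ := exists_subseq_tendsto_ae
      ((tendsto_convSourceLp μ hf x g').comp (hn₁.comp hn₂))
    have hT := ae_all_iff.2 fun n =>
      coeFn_fiberOpLp μ L x g (cocycleDerivation c hc.continuous (f n))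
    have hg := ae_all_iff.2 fun n => coeFn_toSourceLp μ x (convCc μ (f n) g)
    have hg'' := ae_all_iff.2 fun n => coeFn_toSourceLp μ x (convCc μ (f n) g')
    filter_upwards [ha₁, ha₂, ha₃, hT, hg, hg'', Lp.coeFn_zero ℂ 2 (μ.measure x)]
      with ζ h1 h2 h3 hT hg hg'' h0
    rw [h0] at h2 h3
    have l1 : Tendsto (fun n => inner ℂ e (fiberOp μ L (cocycleDerivation c hc.continuous
        (f (n₁ (n₂ (n₃ n))))) g ζ)) atTop (𝓝 (inner ℂ e (y ζ))) := by
      refine Tendsto.inner tendsto_const_nhds ?_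
      exact ((h1.comp (hn₂.comp hn₃))).congr fun n => hT _
    have l2 : Tendsto (fun n => conv μ (f (n₁ (n₂ (n₃ n)))) g (𝒢.inv ζ.1)) atTop (𝓝 0) :=
      (h2.comp hn₃).congr fun n => hg _
    have l3 : Tendsto (fun n => conv μ (f (n₁ (n₂ (n₃ n)))) g' (𝒢.inv ζ.1)) atTop (𝓝 0) :=
      h3.congr fun n => hg'' _
    have l4 := (l3.const_mul Complex.I).sub
      (l2.const_mul (Complex.I * inner ℂ e (secAt c ζ.1 ζ.2)))
    rw [mul_zero, mul_zero, sub_zero] at l4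
    exact tendsto_nhds_unique (l1.congr fun n => hg' _ _) l4
  -- The null set in `key` depends on `e`, and `E x` need not be separable. The essential range of
  -- `y` is separable, which reduces the question to countably many functionals.
  obtain ⟨t, ht, hyt⟩ := (Lp.aestronglyMeasurable y).isSeparable_ae_range
  refine Lp.ext ((ae_eq_zero_of_forall_dual_of_isSeparable ℂ ht (fun l => ?_) hyt).trans
    (Lp.coeFn_zero _ _ _).symm)
  filter_upwards [key ((InnerProductSpace.toDual ℂ (E x)).symm l)] with ζ hζ
  simpa using hζ

end Closability

theorem mainTheorem5 {X : Type u} {G : Type v} [TopologicalSpace X] [TopologicalSpace G]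
    [T2Space G] [LocallyCompactSpace G] [SecondCountableTopology G]
    [MeasurableSpace G] [BorelSpace G]
    (𝒢 : TopGroupoid X G) (μ : HaarSystem 𝒢)
    (E : X → Type w) [∀ x, NormedAddCommGroup (E x)] [∀ x, InnerProductSpace ℂ (E x)]
    [TopologicalSpace (TotalSpace ℂ E)] [IsHilbertBundle E]
    (L : GroupoidAction 𝒢 E) (c : ∀ γ : G, E (𝒢.r γ)) (hc : IsContinuousCocycle L c) :
    IsDerivation μ L (toFullModule μ E) (cocycleDerivation c hc.continuous) ∧
    IsDerivation μ L (toReducedModule μ E) (cocycleDerivation c hc.continuous) ∧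
    ∃ D : NormCompletion (fun f : C_c(G, ℂ) => reducedNorm μ f) →ₗ.[ℂ]
        NormCompletion (fun ξ : CcSections 𝒢 E => moduleNorm μ (reducedNorm μ) ξ.1),
      D.graph = LinearMap.range ((toReducedCStar μ).prod
        ((toReducedModule μ E).comp (cocycleDerivation c hc.continuous))) ∧
      D.IsClosable := by
  refine ⟨isDerivation_cocycleDerivation μ hc _, isDerivation_cocycleDerivation μ hc _, ?_⟩
  have hcompl (x : X) : CompleteSpace (E x) := IsHilbertBundle.complete x
  set R := LinearMap.range ((toReducedCStar μ).prod
    ((toReducedModule μ E).comp (cocycleDerivation c hc.continuous))) with hR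
  have key : ∀ z ∈ R.topologicalClosure, z.1 = 0 → z.2 = 0 := fun z hz hz0 =>
    eq_zero_of_mem_closure_range (ι := {i : X × C_c(G, ℂ) // sourceL2Norm μ i.1 i.2 ≤ 1})
      (H := fun i => Lp (E i.1.1) 2 (μ.measure i.1.1)) (cocycleDerivation c hc.continuous)
      (fun i => fiberOpLp μ L i.1.1 i.1.2) (moduleNorm_reducedNorm_lt_top μ)
      (fun i ξ => enorm_fiberOpLp_le μ L i.1.1 i.1.2 i.2 ξ)
      (fun ξ C hC0 hC => moduleNorm_reducedNorm_le μ L ξ hC0 fun x g hg => hC ⟨(x, g), hg⟩)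
      (fun i f y hf hy => eq_zero_of_tendsto_fiberOpLp μ hc i.1.1 i.1.2 hf hy) hz hz0
  -- Well-definedness of `∂` on the image of `C_c(G)` is the case of `key` for points of `R` itself.
  have hD : R.toLinearPMap.graph = R :=
    R.toLinearPMap_graph_eq fun z hz hz0 => key z (R.le_topologicalClosure hz) hz0
  refine ⟨R.toLinearPMap, hD, R.topologicalClosure.toLinearPMap, ?_⟩
  rw [hD, R.topologicalClosure.toLinearPMap_graph_eq key]
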